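/- **Model.** A bandit has state space $\{1,\dots,d\}$, actions $0$ (passive) and $1$ (active), stochastic matrices $\mathbf P^0,\mathbf P^1$ and reward vectors $\mathbf R^0,\mathbf R^1$. It is *(aperiodic) unichain* if, for every stationary policy $\pi:\{1,\dots,d\}\to\{0,1\}$, the chain with transition probabilities $P^{\pi(i)}_{ij}$ is irreducible and aperiodic. For $\nu\in\mathbb R$, the subsidy-$\nu$ problem is the long-run average reward problem for one bandit with reward $R^1_i$ for action $1$ and $R^0_i+\nu$ for action $0$ in state $i$; $\omega(\nu)$ is the set of states in which some optimal policy is passive. The bandit is *strictly indexable* if $\nu\le\nu'$ implies $\omega(\nu)\subseteq\omega(\nu')$ and the Whittle indices $\nu_i=\inf\{\nu : i\in\omega(\nu)\}$ are pairwise distinct; number the states so that $\nu_1>\dots>\nu_d$. Let $\alpha\in[0,1]$. In the problem with $N$ bandits, the bandits move independently given the actions $a_n(t)$, and bandit $n$, in state $S_n(t)$, earns $R^{a_n(t)}_{S_n(t)}$. Let $V^{(N)}_{\mathrm{rel}}(\alpha)$ be the supremum of $\lim_{T\to\infty}\frac1T\mathbb E\big[\sum_{t<T}\sum_{n} R^{a_n(t)}_{S_n(t)}\big]$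 over the (possibly randomized) stationary Markovian policies with $\lim_{T\to\infty}\frac1T\mathbb E\big[\sum_{t<T}\sum_n a_n(t)\big]=\alpha N$. For $\alpha N\in\mathbb N$, let $V^{(N)}_{\mathrm{WIP}}(\alpha)$ be the long-run average expected reward of the Whittle index policy, which at each time activates the $\alpha N$ bandits whose current states have the highest indices (the choice among bandits in the same state being arbitrary). Let $\Delta^d$ be the unit simplex in $\mathbb R^d$. For $\mathbf m\in\Delta^d$ let $x_i(\mathbf m)=\min\big(m_i,\max(0,\alpha-\sum_{j<i}m_j)\big)$, the mass of state $i$ activated by the Whittle index policy, and let $\phi_j(\mathbf m)=\sum_i\big(x_i(\mathbf m)P^1_{ij}+(m_i-x_i(\mathbf m))P^0_{ij}\big)$. A point $\mathbf m$ is *singular* if $\sum_{j\le i}m_j=\alpha$ for some $i\in\{1,\dots,d\}$. **Theorem.** Consider a synchronous restless bandit problem $\{(\mathbf P^0,\mathbf P^1,\mathbf R^0,\mathbf R^1);\alpha\}$ such that 1. the bandits are unichain and strictly indexable; 2. the (unique) fixed point $\mathbf m^*\in\Delta^d$ of $\phi$ is a uniform global attractor: for every $\epsilon>0$ there is $T(\epsilon)$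 such that $\|\phi^{t}(\mathbf m)-\mathbf m^*\|_\infty\le\epsilon$ for all $t\ge T(\epsilon)$ and all $\mathbf m\in\Delta^d$, where $\phi^t$ is the $t$-th iterate; 3. $\mathbf m^*$ is not singular. Then there are constants $b,c>0$, depending only on $\mathbf P^0,\mathbf P^1,\mathbf R^0,\mathbf R^1$ and $\alpha$, such that for every $N$ with $\alpha N$ an integer, $V^{(N)}_{\mathrm{rel}}(\alpha)$ does not depend on the initial states of the bandits and, for all initial states in the Whittle index problem, $$0\le V^{(N)}_{\mathrm{rel}}(\alpha)-V^{(N)}_{\mathrm{WIP}}(\alpha)\le b\,e^{-cN}.$$ -/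

import Mathlib

/-- A finite-state two-action restless bandit with `d` states. Action `true` is the active action 1
and `false` is the passive action 0: `P a i j` is the probability of moving from `i` to `j` under
action `a`, and `R a i` is the reward for taking action `a` in state `i`. -/
structure Bandit (d : ℕ) where
  P : Bool → Matrix (Fin d) (Fin d) ℝ
  R : Bool → Fin d → ℝ
  stochastic : ∀ a, P a ∈ Matrix.rowStochastic ℝ (Fin d)

/-- `f` has long-run (Cesàro) average `v`: `lim_{T → ∞} (1/T) ∑_{t < T} f t = v`. -/
def HasLongRunAverage (f : ℕ → ℝ) (v : ℝ) : Prop :=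
  Filter.Tendsto (fun T : ℕ => (∑ t ∈ Finset.range T, f t) / (T : ℝ)) Filter.atTop (nhds v)

/-- Every state can be reached from every state. -/
def Matrix.StatesCommunicate {d : ℕ} (Q : Matrix (Fin d) (Fin d) ℝ) : Prop :=
  ∀ i j, ∃ k : ℕ, 0 < (Q ^ k) i j

/-- For every state, the possible return times have no common divisor other than `1`. -/
def Matrix.AperiodicStates {d : ℕ} (Q : Matrix (Fin d) (Fin d) ℝ) : Prop :=
  ∀ i, ∀ p : ℕ, (∀ k : ℕ, 0 < k → 0 < (Q ^ k) i i → p ∣ k) → p = 1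

namespace Bandit

variable {d : ℕ} (B : Bandit d)

/-! ### A single bandit -/

/-- Transition matrix of one bandit under the stationary policy `π`. -/
def policyMatrix (π : Fin d → Bool) : Matrix (Fin d) (Fin d) ℝ :=
  Matrix.of fun i j => B.P (π i) i j

/-- Aperiodic unichain bandit: the states form a single aperiodic closed class, regardless of the
stationary policy employed. -/
def IsUnichain : Prop :=
  ∀ π : Fin d → Bool, (B.policyMatrix π).StatesCommunicate ∧ (B.policyMatrix π).AperiodicStates

/-- One-step reward under `π` in the subsidy-`ν` problem: the passive action earns an extra `ν`. -/
def subsidyReward (ν : ℝ) (π : Fin d → Bool) (i : Fin d) : ℝ :=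
  B.R (π i) i + if π i = false then ν else 0

/-- Expected reward at time `t` in the subsidy-`ν` problem, under `π`, started in state `i`. -/
noncomputable def subsidyExpectedReward (ν : ℝ) (π : Fin d → Bool) (i : Fin d) (t : ℕ) : ℝ :=
  ((B.policyMatrix π ^ t).mulVec (B.subsidyReward ν π)) i

/-- `π` maximizes the long-run average reward of the subsidy-`ν` problem from every state. -/
def IsSubsidyOptimal (ν : ℝ) (π : Fin d → Bool) : Prop :=
  ∀ i, ∃ g, HasLongRunAverage (B.subsidyExpectedReward ν π i) g ∧
    ∀ π' g', HasLongRunAverage (B.subsidyExpectedReward ν π' i) g' → g' ≤ g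

/-- `ω(ν)`: the states in which some optimal policy of the subsidy-`ν` problem is passive. -/
def passiveSet (ν : ℝ) : Set (Fin d) :=
  {i | ∃ π, B.IsSubsidyOptimal ν π ∧ π i = false}

/-- Indexability: `ω(ν)` is nondecreasing in `ν`. -/
def IsIndexable : Prop := Monotone B.passiveSet

/-- Whittle index of state `i`. -/
noncomputable def whittleIndex (i : Fin d) : ℝ := sInf {ν | i ∈ B.passiveSet ν}

/-- Strict indexability: indexable, and no two states have the same Whittle index. -/
def IsStrictlyIndexable : Prop := B.IsIndexable ∧ Function.Injective B.whittleIndex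

/-! ### The mean-field map -/

/-- The mass of state `i` that is activated by the Whittle index policy in configuration `m`:
the active mass `α` is given to the states by decreasing Whittle index, so state `i` gets
what the states of larger index have left over, up to `m i`. -/
noncomputable def activeMass (α : ℝ) (m : Fin d → ℝ) (i : Fin d) : ℝ :=
  min (m i) (max 0 (α - ∑ j with B.whittleIndex i < B.whittleIndex j, m j))

/-- The mean-field map `φ`. -/
noncomputable def meanField (α : ℝ) (m : Fin d → ℝ) (j : Fin d) : ℝ :=
  ∑ i, (B.activeMass α m i * B.P true i j + (m i - B.activeMass α m i) * B.P false i j)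

/-- `m` is singular if, for some state `i`, the states of index at least that of `i` have total
mass exactly `α`. -/
def IsSingular (α : ℝ) (m : Fin d → ℝ) : Prop :=
  ∃ i, ∑ j with B.whittleIndex i ≤ B.whittleIndex j, m j = α

/-- `m₀` attracts all orbits of `φ` in the simplex, uniformly in the initial point (the norm on
`Fin d → ℝ` is the sup norm). -/
def IsUniformGlobalAttractor (α : ℝ) (m₀ : Fin d → ℝ) : Prop :=
  ∀ ε > (0 : ℝ), ∃ T : ℕ, ∀ t ≥ T, ∀ m ∈ stdSimplex ℝ (Fin d),
    ‖(B.meanField α)^[t] m - m₀‖ ≤ ε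

/-! ### The system of `N` bandits -/

/-- A stationary Markovian (possibly randomized) policy for `N` bandits: to each state vector, a
probability distribution on the action vectors. -/
abbrev Policy (d N : ℕ) : Type := (Fin N → Fin d) → stdSimplex ℝ (Fin N → Bool)

variable {N : ℕ}

/-- Transition matrix of the `N` bandits under `π`: given the action vector, the bandits move
independently. -/
noncomputable def jointMatrix (π : Policy d N) :
    Matrix (Fin N → Fin d) (Fin N → Fin d) ℝ :=
  Matrix.of fun s s' => ∑ a, (π s).1 a * ∏ n, B.P (a n) (s n) (s' n)

/-- Expected total one-step reward of the `N` bandits in state vector `s` under `π`. -/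
noncomputable def jointReward (π : Policy d N) (s : Fin N → Fin d) : ℝ :=
  ∑ a, (π s).1 a * ∑ n, B.R (a n) (s n)

/-- Expected number of activated bandits in state vector `s` under `π`. -/
noncomputable def jointActive (π : Policy d N) (s : Fin N → Fin d) : ℝ :=
  ∑ a, (π s).1 a * ∑ n, if a n = true then 1 else 0

/-- Expected total reward at time `t` under `π`, started in `s`. -/
noncomputable def expectedReward (π : Policy d N) (s : Fin N → Fin d) (t : ℕ) : ℝ :=
  ((B.jointMatrix π ^ t).mulVec (B.jointReward π)) s

/-- Expected number of bandits activated at time `t` under `π`, started in `s`. -/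
noncomputable def expectedActive (π : Policy d N) (s : Fin N → Fin d) (t : ℕ) : ℝ :=
  ((B.jointMatrix π ^ t).mulVec (jointActive π)) s

/-- Long-run average rewards, from the initial state vector `s`, of the policies that meet the
relaxed constraint: the long-run average number of activated bandits is `α N`. -/
def relaxedRewards (α : ℝ) (s : Fin N → Fin d) : Set ℝ :=
  {v | ∃ π : Policy d N, HasLongRunAverage (B.expectedActive π s) (α * N) ∧
    HasLongRunAverage (B.expectedReward π s) v}

/-- `V` is the value of the relaxed problem with `N` bandits, whatever the initial state vector. -/
def IsRelaxedValue (α : ℝ) (N : ℕ) (V : ℝ) : Prop :=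
  ∀ s : Fin N → Fin d, IsLUB (B.relaxedRewards α s) V

/-- `π` is a Whittle index policy: it activates exactly `α N` bandits, and these have the highest
Whittle indices. Nothing is said on the choice among bandits that are in the same state. -/
def IsWhittlePolicy (α : ℝ) (π : Policy d N) : Prop :=
  ∀ s a, (π s).1 a ≠ 0 →
    ((Finset.univ.filter fun n => a n = true).card : ℝ) = α * N ∧
    ∀ n n', a n = true → a n' = false → B.whittleIndex (s n') ≤ B.whittleIndex (s n)

end Bandit

/-! The proof is Lagrangian relaxation at a single multiplier. Let `i` be the state of `mstar` at
which the active mass `α` runs out, `ν` its Whittle index, and `(g, h)` a solution of the optimality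
equation for subsidy `ν`. Its residual is nonpositive, and vanishes for the active action at indices
at least `ν` and for the passive action at indices at most `ν` (`exists_bellman_whittle`). Summing
`h` over the bandits, `jointReward_eq` writes the joint reward as `N (g - ν)` plus `ν` times the
number of active bandits, a telescoping term and the total residual. So a policy activating `α N`
bandits on average earns `N (g - ν) + ν α N + l`, where `l ≤ 0` is its average residual.

The value `l = 0` is attained in the relaxed problem by activating bandits independently with the
threshold probabilities `θ` read off `mstar`: the fixed-point equation says that `mstar` is
stationary under `θ`, so the constraint holds (`isRelaxedValue`).

For a Whittle policy the gap is therefore exactly `-l`. Since `mstar` is nonsingular, `i` stays a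
threshold state throughout a neighbourhood of `mstar`, and there Whittle actions have zero residual.
The conditional mean of the next configuration is exactly `φ` of the present one, with exponentially
unlikely deviations. Finitely many steps compound by uniform continuity, and uniform attraction
gives a time `T`, independent of `N` and of the start, after which the neighbourhood is missed with
probability at most `C e^{-cN}`. Hence `-l ≤ N K C e^{-cN}`, and halving the rate absorbs the factor
`N`. -/

/-! ### Cesàro averages. -/

namespace HasLongRunAverage

variable {u v : ℕ → ℝ} {a b : ℝ}

theorem unique (hu : HasLongRunAverage u a) (hu' : HasLongRunAverage u b) : a = b :=
  tendsto_nhds_unique hu hu'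

theorem add (hu : HasLongRunAverage u a) (hv : HasLongRunAverage v b) :
    HasLongRunAverage (fun t => u t + v t) (a + b) := by
  unfold HasLongRunAverage at *
  simpa only [Finset.sum_add_distrib, add_div] using hu.add hv

theorem const_mul (c : ℝ) (hu : HasLongRunAverage u a) :
    HasLongRunAverage (fun t => c * u t) (c * a) := by
  unfold HasLongRunAverage at *
  simpa only [← Finset.mul_sum, mul_div_assoc] using Filter.Tendsto.const_mul c hu

theorem const (c : ℝ) : HasLongRunAverage (fun _ => c) c := by
  refine tendsto_const_nhds.congr' ?_
  filter_upwards [Filter.eventually_gt_atTop 0] with T hT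
  have : (T : ℝ) ≠ 0 := by positivity
  simp [this]

theorem of_telescope {C : ℝ} (hu : ∀ t, |u t| ≤ C) :
    HasLongRunAverage (fun t => u t - u (t + 1)) 0 := by
  unfold HasLongRunAverage
  simp only [Finset.sum_range_sub']
  refine squeeze_zero_norm (a := fun T : ℕ => 2 * C / (T : ℝ)) (fun T => ?_)
    (tendsto_const_div_atTop_nhds_zero_nat _)
  rw [norm_div, Real.norm_natCast, Real.norm_eq_abs]
  gcongr
  have := abs_sub (u 0) (u T)
  linarith [hu 0, hu T]

/-- The long-run average only depends on the tail of a bounded sequence. -/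
theorem le_of_eventually_le {C K : ℝ} {T₀ : ℕ} (hK : 0 ≤ K) (hu : HasLongRunAverage u a)
    (hC : ∀ t, u t ≤ C) (hle : ∀ t ≥ T₀, u t ≤ K) : a ≤ K := by
  have hlim : Filter.Tendsto (fun T : ℕ => T₀ * |C| / (T : ℝ) + K) Filter.atTop (nhds (0 + K)) :=
    (tendsto_const_div_atTop_nhds_zero_nat _).add_const K
  rw [zero_add] at hlim
  refine le_of_tendsto_of_tendsto hu hlim ?_
  filter_upwards [Filter.eventually_gt_atTop 0] with T hT
  have hT' : (0 : ℝ) < T := by positivity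
  rw [div_add' _ _ _ hT'.ne']
  gcongr
  have hpt : ∀ t ∈ Finset.range T, u t ≤ (if t < T₀ then |C| else 0) + K := by
    intro t _
    split_ifs with h
    · linarith [hC t, le_abs_self C]
    · linarith [hle t (not_lt.mp h)]
  refine (Finset.sum_le_sum hpt).trans ?_
  rw [Finset.sum_add_distrib, Finset.sum_const, Finset.card_range, nsmul_eq_mul,
    ← Finset.sum_filter, Finset.sum_const, nsmul_eq_mul, mul_comm K]
  gcongr
  refine (Finset.card_le_card (t := Finset.range T₀) ?_).trans (Finset.card_range T₀).le
  intro t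
  simp

end HasLongRunAverage

/-! ### Stochastic matrices and the Poisson equation. -/

namespace Matrix

theorem exists_forall_abs_le {ι : Type*} [Fintype ι] (v : ι → ℝ) : ∃ C, ∀ i, |v i| ≤ C :=
  ⟨∑ i, |v i|, fun i => Finset.single_le_sum (f := fun i => |v i|)
    (fun _ _ => abs_nonneg _) (Finset.mem_univ i)⟩

section Stochastic

variable {ι : Type*} [Fintype ι] [DecidableEq ι] {Q : Matrix ι ι ℝ}

theorem mulVec_mono_of_mem_rowStochastic (hQ : Q ∈ rowStochastic ℝ ι) {u v : ι → ℝ}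
    (huv : u ≤ v) : Q *ᵥ u ≤ Q *ᵥ v := fun i =>
  Finset.sum_le_sum fun j _ => mul_le_mul_of_nonneg_left (huv j) (hQ.1 i j)

theorem mulVec_const_of_mem_rowStochastic (hQ : Q ∈ rowStochastic ℝ ι) (c : ℝ) :
    (Q *ᵥ fun _ => c) = fun _ => c := by
  ext i
  simp [mulVec, dotProduct, ← Finset.sum_mul, sum_row_of_mem_rowStochastic hQ i]

theorem abs_mulVec_le_of_mem_rowStochastic (hQ : Q ∈ rowStochastic ℝ ι) {v : ι → ℝ} {C : ℝ}
    (hv : ∀ i, |v i| ≤ C) (i : ι) : |(Q *ᵥ v) i| ≤ C := by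
  rw [abs_le]
  constructor
  · have := mulVec_mono_of_mem_rowStochastic hQ (u := fun _ => -C) (v := v)
      (fun i => (abs_le.mp (hv i)).1) i
    rwa [mulVec_const_of_mem_rowStochastic hQ] at this
  · have := mulVec_mono_of_mem_rowStochastic hQ (u := v) (v := fun _ => C)
      (fun i => (abs_le.mp (hv i)).2) i
    rwa [mulVec_const_of_mem_rowStochastic hQ] at this

theorem pow_mulVec_of_eq {w : ι → ℝ} (hw : Q *ᵥ w = w) (t : ℕ) : Q ^ t *ᵥ w = w := by
  induction t with
  | zero => simp
  | succ t ih => rw [pow_succ, ← mulVec_mulVec, hw, ih]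

/-- A vector of the form `w + (h - Q h)` with `Q w = w` has long-run average `w`. -/
theorem hasLongRunAverage_of_eq (hQ : Q ∈ rowStochastic ℝ ι) {r w h : ι → ℝ} (hw : Q *ᵥ w = w)
    (hr : r = w + (h - Q *ᵥ h)) (i : ι) :
    HasLongRunAverage (fun t => (Q ^ t *ᵥ r) i) (w i) := by
  obtain ⟨C, hC⟩ := exists_forall_abs_le h
  have h1 := HasLongRunAverage.of_telescope (u := fun t => (Q ^ t *ᵥ h) i) (C := C)
    fun t => abs_mulVec_le_of_mem_rowStochastic (pow_mem hQ t) hC i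
  have h2 := (HasLongRunAverage.const (w i)).add h1
  rw [add_zero] at h2
  convert h2 using 2 with t
  rw [hr, mulVec_add, mulVec_sub, pow_mulVec_of_eq hw, mulVec_mulVec, ← pow_succ]
  rfl

/-- The kernel and the range of `I - Q` meet only in zero, because a common element has both itself
and zero as long-run average; by rank-nullity they are complementary. No irreducibility is needed,
so this also covers the joint chain of `N` bandits. -/
theorem exists_eq_add_sub_mulVec (hQ : Q ∈ rowStochastic ℝ ι) (r : ι → ℝ) :
    ∃ w h : ι → ℝ, Q *ᵥ w = w ∧ r = w + (h - Q *ᵥ h) := by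
  set f : (ι → ℝ) →ₗ[ℝ] (ι → ℝ) := LinearMap.id - Q.mulVecLin with hf
  have hdis : Disjoint (LinearMap.ker f) (LinearMap.range f) := by
    rw [Submodule.disjoint_def]
    rintro x hx ⟨y, rfl⟩
    have hx' : Q *ᵥ (f y) = f y := (sub_eq_zero.mp (LinearMap.mem_ker.mp hx)).symm
    ext i
    -- the average of `f y = y - Q y` is both `f y` and `0`
    have h1 := hasLongRunAverage_of_eq hQ (r := f y) (w := f y) (h := 0) hx' (by simp) i
    have h2 := hasLongRunAverage_of_eq hQ (r := f y) (w := 0) (h := y) (by simp)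
      (by simp [hf]) i
    exact h1.unique h2
  have hcompl : IsCompl (LinearMap.ker f) (LinearMap.range f) := by
    rw [Submodule.isCompl_iff_disjoint _ _ ?_]
    · exact hdis
    · rw [add_comm, LinearMap.finrank_range_add_finrank_ker]
  obtain ⟨w, hw, _, ⟨h, rfl⟩, hr⟩ := Submodule.mem_sup.mp
    (hcompl.sup_eq_top ▸ Submodule.mem_top (x := r))
  exact ⟨w, h, (sub_eq_zero.mp (LinearMap.mem_ker.mp hw)).symm, hr.symm⟩

theorem exists_hasLongRunAverage (hQ : Q ∈ rowStochastic ℝ ι) (r : ι → ℝ) (i : ι) :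
    ∃ a, HasLongRunAverage (fun t => (Q ^ t *ᵥ r) i) a := by
  obtain ⟨w, h, hw, hr⟩ := exists_eq_add_sub_mulVec hQ r
  exact ⟨_, hasLongRunAverage_of_eq hQ hw hr i⟩

end Stochastic

section Communicating

variable {d : ℕ} {Q : Matrix (Fin d) (Fin d) ℝ}

/-- Minimum principle: at a minimizer `m` of `y`, row `m` of `Q ^ k` averages the nonnegative `y - y
m` to at most zero, so `y` equals its minimum at every state reached from `m`. -/
theorem StatesCommunicate.eq_of_mulVec_le (hc : Q.StatesCommunicate)
    (hQ : Q ∈ rowStochastic ℝ (Fin d)) {y : Fin d → ℝ} (hy : Q *ᵥ y ≤ y) (i j : Fin d) :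
    y i = y j := by
  have hpow : ∀ k, Q ^ k *ᵥ y ≤ y := by
    intro k
    induction k with
    | zero => simp
    | succ k ih =>
      rw [pow_succ', ← mulVec_mulVec]
      exact (mulVec_mono_of_mem_rowStochastic hQ ih).trans hy
  have : Nonempty (Fin d) := ⟨i⟩
  obtain ⟨m, hm⟩ := Finite.exists_min y
  suffices h : ∀ j, y j = y m by rw [h i, h j]
  intro j
  obtain ⟨k, hk⟩ := hc m j
  have hQk := pow_mem hQ k
  have hle : ∑ l, (Q ^ k) m l * (y l - y m) ≤ 0 := by
    simp only [mul_sub, Finset.sum_sub_distrib, ← Finset.sum_mul,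
      sum_row_of_mem_rowStochastic hQk m, one_mul]
    exact sub_nonpos.mpr (hpow k m)
  have hj := (Finset.single_le_sum (f := fun l => (Q ^ k) m l * (y l - y m))
    (fun l _ => mul_nonneg (hQk.1 m l) (sub_nonneg.mpr (hm l))) (Finset.mem_univ j)).trans hle
  have := nonpos_of_mul_nonpos_right hj hk
  linarith [hm j]

theorem StatesCommunicate.exists_poisson (hc : Q.StatesCommunicate)
    (hQ : Q ∈ rowStochastic ℝ (Fin d)) (r : Fin d → ℝ) :
    ∃ (g : ℝ) (h : Fin d → ℝ), r = (fun _ => g) + (h - Q *ᵥ h) := by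
  obtain ⟨w, h, hw, hr⟩ := exists_eq_add_sub_mulVec hQ r
  rcases isEmpty_or_nonempty (Fin d) with hd | ⟨⟨i⟩⟩
  · exact ⟨0, h, Subsingleton.elim _ _⟩
  · refine ⟨w i, h, hr.trans ?_⟩
    rw [show w = fun _ => w i from funext fun j => hc.eq_of_mulVec_le hQ hw.le j i]

theorem hasLongRunAverage_of_poisson {ι : Type*} [Fintype ι] [DecidableEq ι] {Q : Matrix ι ι ℝ}
    (hQ : Q ∈ rowStochastic ℝ ι) {r h : ι → ℝ} {g : ℝ}
    (hr : r = (fun _ => g) + (h - Q *ᵥ h)) (i : ι) :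
    HasLongRunAverage (fun t => (Q ^ t *ᵥ r) i) g :=
  hasLongRunAverage_of_eq hQ (mulVec_const_of_mem_rowStochastic hQ g) hr i

/-- A nonzero nonnegative reward has positive gain. -/
theorem StatesCommunicate.gain_pos (hc : Q.StatesCommunicate)
    (hQ : Q ∈ rowStochastic ℝ (Fin d)) {r h : Fin d → ℝ} {g : ℝ}
    (hr : r = (fun _ => g) + (h - Q *ᵥ h)) (h0 : 0 ≤ r) {i : Fin d} (hi : r i ≠ 0) : 0 < g := by
  by_contra! hg
  -- With `g ≤ 0 ≤ r`, the equation makes `h` superharmonic, hence constant, which leaves `r = g ≤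
  -- 0`.
  have hr' : ∀ j, r j = g + (h j - (Q *ᵥ h) j) := fun j => congrFun hr j
  have hconst := hc.eq_of_mulVec_le hQ (y := h) fun j => by
    have := hr' j
    have := h0 j
    simp only [Pi.zero_apply] at this
    linarith
  have hh : Q *ᵥ h = h := by
    rw [show h = fun _ => h i from funext fun j => hconst j i]
    exact mulVec_const_of_mem_rowStochastic hQ _
  have := hr' i
  rw [hh, sub_self, add_zero] at this
  exact hi (le_antisymm (this ▸ hg) (h0 i))

end Communicating

end Matrix

/-! ### One bandit: gains, Whittle indices, optimality equation. -/

namespace Bandit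

open Matrix

section SingleBandit

variable {d : ℕ} {B : Bandit d}

theorem policyMatrix_mem (B : Bandit d) (π : Fin d → Bool) :
    B.policyMatrix π ∈ rowStochastic ℝ (Fin d) :=
  mem_rowStochastic_iff_sum.mpr ⟨fun i j => (B.stochastic (π i)).1 i j,
    fun i => sum_row_of_mem_rowStochastic (B.stochastic (π i)) i⟩

theorem policyMatrix_mulVec (B : Bandit d) (π : Fin d → Bool) (h : Fin d → ℝ) (i : Fin d) :
    (B.policyMatrix π *ᵥ h) i = (B.P (π i) *ᵥ h) i := rfl

/-- Gains are affine functions of the subsidy, the slope being the passive frequency. -/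
theorem IsUnichain.exists_gain (huni : B.IsUnichain) :
    ∃ G p : (Fin d → Bool) → ℝ,
      (∀ ν π i, HasLongRunAverage (B.subsidyExpectedReward ν π i) (G π + ν * p π)) ∧
      (∀ π i, π i = false → 0 < p π) ∧ (∀ π i, π i = true → p π < 1) ∧
      (Nonempty (Fin d) → p (fun _ => true) = 0) ∧
      (Nonempty (Fin d) → p (fun _ => false) = 1) := by
  choose G k hG using fun π => (huni π).1.exists_poisson (B.policyMatrix_mem π)
    fun i => B.R (π i) i
  choose p l hp using fun π => (huni π).1.exists_poisson (B.policyMatrix_mem π)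
    fun i => if π i = false then (1 : ℝ) else 0
  refine ⟨G, p, fun ν π i => ?_, fun π i hi => ?_, fun π i hi => ?_, fun ⟨i⟩ => ?_, fun ⟨i⟩ => ?_⟩
  · refine hasLongRunAverage_of_poisson (B.policyMatrix_mem π) (h := k π + ν • l π) ?_ i
    ext j
    have h1 := congrFun (hG π) j
    have h2 := congrFun (hp π) j
    simp only [Pi.add_apply, Pi.sub_apply] at h1 h2
    have h3 : B.subsidyReward ν π j
        = B.R (π j) j + ν * (if π j = false then (1 : ℝ) else 0) := by simp [subsidyReward]
    rw [h3, h1, h2, mulVec_add, mulVec_smul]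
    simp only [Pi.add_apply, Pi.sub_apply, Pi.smul_apply, smul_eq_mul]
    ring
  · refine (huni π).1.gain_pos (B.policyMatrix_mem π) (hp π) (fun j => ?_) (i := i) (by simp [hi])
    dsimp only [Pi.zero_apply]
    split_ifs <;> norm_num
  · have : 0 < 1 - p π := by
      refine (huni π).1.gain_pos (B.policyMatrix_mem π) (h := - l π)
        (r := fun j => 1 - if π j = false then (1 : ℝ) else 0) ?_ (fun j => ?_) (i := i)
        (by simp [hi])
      · ext j
        have h2 := congrFun (hp π) j
        simp only [Pi.add_apply, Pi.sub_apply] at h2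
        rw [h2, mulVec_neg]
        simp only [Pi.add_apply, Pi.sub_apply, Pi.neg_apply]
        ring
      · dsimp only [Pi.zero_apply]
        split_ifs <;> norm_num
    linarith
  · have h1 := hasLongRunAverage_of_poisson (B.policyMatrix_mem fun _ => true)
      (hp fun _ => true) i
    have h2 := hasLongRunAverage_of_poisson (B.policyMatrix_mem fun _ => true)
      (r := 0) (g := 0) (h := 0) (by ext; simp) i
    refine h1.unique ?_
    convert h2 using 4; simp
  · have h1 := hasLongRunAverage_of_poisson (B.policyMatrix_mem fun _ => false)
      (hp fun _ => false) i
    have h2 := hasLongRunAverage_of_poisson (B.policyMatrix_mem fun _ => false)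
      (r := 1) (g := 1) (h := 0) (by ext; simp) i
    refine h1.unique ?_
    convert h2 using 4; simp

theorem isSubsidyOptimal_iff_of_gain [Nonempty (Fin d)] {ν : ℝ} {g : (Fin d → Bool) → ℝ}
    (hg : ∀ π i, HasLongRunAverage (B.subsidyExpectedReward ν π i) (g π)) (π : Fin d → Bool) :
    B.IsSubsidyOptimal ν π ↔ ∀ π', g π' ≤ g π := by
  constructor
  · intro h π'
    obtain ⟨i⟩ := ‹Nonempty (Fin d)›
    obtain ⟨a, ha, hmax⟩ := h i
    rw [(hg π i).unique ha]
    exact hmax π' _ (hg π' i)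
  · intro h i
    refine ⟨g π, hg π i, fun π' g' h' => ?_⟩
    rw [h'.unique (hg π' i)]
    exact h π'

theorem IsUnichain.exists_isSubsidyOptimal [Nonempty (Fin d)] (huni : B.IsUnichain) (ν : ℝ) :
    ∃ π, B.IsSubsidyOptimal ν π := by
  obtain ⟨G, p, hG, -⟩ := huni.exists_gain
  obtain ⟨π, hπ⟩ := Finite.exists_max fun π => G π + ν * p π
  exact ⟨π, (isSubsidyOptimal_iff_of_gain (hG ν) π).mpr hπ⟩

/-- Gains are affine in `ν` and there are finitely many policies, so this is a finite union of
intersections of closed sets. Closedness lets optimal actions be read off at the index itself. -/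
theorem IsUnichain.isClosed_setOf_optimal_action [Nonempty (Fin d)] (huni : B.IsUnichain)
    (i : Fin d) (a : Bool) : IsClosed {ν | ∃ π, B.IsSubsidyOptimal ν π ∧ π i = a} := by
  obtain ⟨G, p, hG, -⟩ := huni.exists_gain
  have : {ν | ∃ π, B.IsSubsidyOptimal ν π ∧ π i = a}
      = ⋃ π ∈ {π : Fin d → Bool | π i = a}, ⋂ π', {ν | G π' + ν * p π' ≤ G π + ν * p π} := by
    ext ν
    simp only [Set.mem_ofPred_eq, Set.mem_iUnion, Set.mem_iInter, exists_prop,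
      isSubsidyOptimal_iff_of_gain (hG ν)]
    exact exists_congr fun π => and_comm
  rw [this]
  refine (Set.toFinite _).isClosed_biUnion fun π _ => isClosed_iInter fun π' => ?_
  exact isClosed_le (by fun_prop) (by fun_prop)

/-- The always-passive policy has slope 1 in `ν` and every other policy a smaller slope, so it is
optimal beyond all crossing points. With the lower bound below, this makes the `sInf` defining the
index genuine rather than a default value. -/
theorem IsUnichain.nonempty_setOf_mem_passiveSet (huni : B.IsUnichain) (i : Fin d) :
    {ν | i ∈ B.passiveSet ν}.Nonempty := by
  have : Nonempty (Fin d) := ⟨i⟩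
  obtain ⟨G, p, hG, -, h1, -, h2⟩ := huni.exists_gain
  -- The always-passive policy contributes a quotient by zero here; it only enlarges the finite set
  -- and is never used.
  obtain ⟨ν, hν⟩ := (Set.toFinite (Set.range fun π => (G π - G fun _ => false) / (1 - p π))).bddAbove
  refine ⟨ν, fun _ => false, (isSubsidyOptimal_iff_of_gain (hG ν) _).mpr fun π => ?_, rfl⟩
  rw [h2 this]
  by_cases hπ : ∃ j, π j = true
  · obtain ⟨j, hj⟩ := hπ
    have h3 : 0 < 1 - p π := sub_pos.mpr (h1 π j hj)
    have h4 := hν ⟨π, rfl⟩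
    rw [div_le_iff₀ h3] at h4
    linarith
  · have : π = fun _ => false := by
      ext j
      simpa using fun h => hπ ⟨j, h⟩
    rw [this, h2 ⟨i⟩]

theorem IsUnichain.bddBelow_setOf_mem_passiveSet (huni : B.IsUnichain) (i : Fin d) :
    BddBelow {ν | i ∈ B.passiveSet ν} := by
  have : Nonempty (Fin d) := ⟨i⟩
  obtain ⟨G, p, hG, h1, -, h2, -⟩ := huni.exists_gain
  obtain ⟨ν, hν⟩ := (Set.toFinite (Set.range fun π => (G (fun _ => true) - G π) / p π)).bddBelow
  refine ⟨ν, fun ν' ⟨π, hopt, hi⟩ => ?_⟩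
  have h3 := (isSubsidyOptimal_iff_of_gain (hG ν') π).mp hopt fun _ => true
  rw [h2 this, mul_zero, add_zero] at h3
  refine (hν ⟨π, rfl⟩).trans ?_
  change _ / _ ≤ _
  rw [div_le_iff₀ (h1 π i hi)]
  linarith

theorem IsUnichain.exists_optimal_passive (huni : B.IsUnichain) (hidx : B.IsIndexable) {i : Fin d}
    {ν : ℝ} (hν : B.whittleIndex i ≤ ν) : ∃ π, B.IsSubsidyOptimal ν π ∧ π i = false := by
  have : Nonempty (Fin d) := ⟨i⟩
  exact hidx hν ((huni.isClosed_setOf_optimal_action i false).csInf_mem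
    (huni.nonempty_setOf_mem_passiveSet i) (huni.bddBelow_setOf_mem_passiveSet i))

/-- Strictly below the index no optimal policy is passive at `i`, so all are active there;
closedness adds the endpoint. -/
theorem IsUnichain.exists_optimal_active (huni : B.IsUnichain) {i : Fin d} {ν : ℝ}
    (hν : ν ≤ B.whittleIndex i) : ∃ π, B.IsSubsidyOptimal ν π ∧ π i = true := by
  have : Nonempty (Fin d) := ⟨i⟩
  have hsub : Set.Iio (B.whittleIndex i) ⊆ {ν | ∃ π, B.IsSubsidyOptimal ν π ∧ π i = true} := by
    intro ν hν
    obtain ⟨π, hπ⟩ := huni.exists_isSubsidyOptimal ν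
    refine ⟨π, hπ, ?_⟩
    by_contra h
    exact notMem_of_lt_csInf hν (huni.bddBelow_setOf_mem_passiveSet i) ⟨π, hπ, by simpa using h⟩
  have := closure_minimal hsub (huni.isClosed_setOf_optimal_action i true)
  rw [closure_Iio] at this
  exact this hν

/-- The excess over zero of the right-hand side of the optimality equation of the subsidy-`ν`
problem, for the candidate gain `g` and bias `h`. -/
def bellmanResidual (B : Bandit d) (ν g : ℝ) (h : Fin d → ℝ) (a : Bool) (i : Fin d) : ℝ :=
  B.R a i + (if a = false then ν else 0) + (B.P a *ᵥ h) i - g - h i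

theorem subsidyReward_eq_bellmanResidual (ν g : ℝ) (h : Fin d → ℝ) (π : Fin d → Bool) :
    B.subsidyReward ν π = (fun i => g + B.bellmanResidual ν g h (π i) i)
      + (h - B.policyMatrix π *ᵥ h) := by
  ext i
  simp only [subsidyReward, bellmanResidual, Pi.add_apply, Pi.sub_apply, policyMatrix_mulVec]
  ring

/-- If a nonzero residual has constant sign `σ` along `π`, then the gain of `π` differs
from `g` in that direction. -/
theorem IsUnichain.exists_gain_of_residual (huni : B.IsUnichain) {ν g σ : ℝ} {h : Fin d → ℝ}
    {π : Fin d → Bool} (hσ : ∀ j, 0 ≤ σ * B.bellmanResidual ν g h (π j) j) {i : Fin d}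
    (hi : σ * B.bellmanResidual ν g h (π i) i ≠ 0) :
    ∃ c, 0 < σ * c ∧ ∀ j, HasLongRunAverage (B.subsidyExpectedReward ν π j) (g + c) := by
  obtain ⟨c, y, hc⟩ := (huni π).1.exists_poisson (B.policyMatrix_mem π)
    fun j => B.bellmanResidual ν g h (π j) j
  refine ⟨c, (huni π).1.gain_pos (B.policyMatrix_mem π) (h := σ • y)
    (r := fun j => σ * B.bellmanResidual ν g h (π j) j) ?_ hσ hi, fun j => ?_⟩
  · ext j
    have := congrFun hc j
    simp only [Pi.add_apply, Pi.sub_apply] at this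
    rw [this, mulVec_smul]
    simp only [Pi.add_apply, Pi.sub_apply, Pi.smul_apply, smul_eq_mul]
    ring
  · refine hasLongRunAverage_of_poisson (B.policyMatrix_mem π) (h := y + h) ?_ j
    rw [subsidyReward_eq_bellmanResidual ν g h π, mulVec_add]
    ext j
    have := congrFun hc j
    simp only [Pi.add_apply, Pi.sub_apply] at this ⊢
    rw [this]
    ring

/-- Optimality equation of the subsidy-`ν` problem; actions used by optimal policies attain it. -/
theorem IsUnichain.exists_bellman [Nonempty (Fin d)] (huni : B.IsUnichain) (ν : ℝ) :
    ∃ (g : ℝ) (h : Fin d → ℝ), (∀ a i, B.bellmanResidual ν g h a i ≤ 0) ∧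
      ∀ π, B.IsSubsidyOptimal ν π → ∀ i, B.bellmanResidual ν g h (π i) i = 0 := by
  obtain ⟨π₀, hπ₀⟩ := huni.exists_isSubsidyOptimal ν
  obtain ⟨g, h, hgh⟩ := (huni π₀).1.exists_poisson (B.policyMatrix_mem π₀) (B.subsidyReward ν π₀)
  have hg : ∀ i, HasLongRunAverage (B.subsidyExpectedReward ν π₀ i) g :=
    hasLongRunAverage_of_poisson (B.policyMatrix_mem π₀) hgh
  have hmax : ∀ π g' i, HasLongRunAverage (B.subsidyExpectedReward ν π i) g' → g' ≤ g := by
    intro π g' i hg'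
    obtain ⟨a, ha, hle⟩ := hπ₀ i
    rw [(hg i).unique ha]
    exact hle π g' hg'
  have hzero : ∀ i, B.bellmanResidual ν g h (π₀ i) i = 0 := by
    intro i
    have h1 := congrFun hgh i
    have h2 := congrFun (subsidyReward_eq_bellmanResidual (B := B) ν g h π₀) i
    simp only [Pi.add_apply, Pi.sub_apply] at h1 h2
    linarith
  have hle : ∀ a i, B.bellmanResidual ν g h a i ≤ 0 := by
    intro a i
    by_contra! hpos
    -- Policy improvement: switching `π₀` to `a` at `i` alone leaves a single, positive residual,
    -- which would raise the gain above `g`.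
    have hval : ∀ j, B.bellmanResidual ν g h (Function.update π₀ i a j) j
        = if j = i then B.bellmanResidual ν g h a i else 0 := by
      intro j
      by_cases hj : j = i
      · subst hj; simp
      · simp [hj, hzero]
    obtain ⟨c, hc, hlra⟩ := huni.exists_gain_of_residual (ν := ν) (g := g) (h := h) (σ := 1)
      (π := Function.update π₀ i a) (i := i)
      (fun j => by rw [hval j, one_mul]; split_ifs <;> simp [hpos.le])
      (by rw [hval i, one_mul, if_pos rfl]; exact hpos.ne')
    linarith [hmax _ _ i (hlra i)]
  refine ⟨g, h, hle, fun π hπ i => ?_⟩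
  -- A policy with a negative residual somewhere has gain strictly below `g`, so it is not optimal.
  by_contra hne
  obtain ⟨c, hc, hlra⟩ := huni.exists_gain_of_residual (ν := ν) (g := g) (h := h) (σ := -1)
      (π := π) (i := i) (fun j => by linarith [hle (π j) j]) (by simpa using hne)
  obtain ⟨a, ha, hopt⟩ := hπ i
  have := hopt π₀ g (hg i)
  rw [ha.unique (hlra i)] at this
  linarith

/-- At a subsidy `ν`, active is conserving in the states of index at least `ν`, and passive in the
states of index at most `ν`. -/
theorem IsUnichain.exists_bellman_whittle [Nonempty (Fin d)] (huni : B.IsUnichain)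
    (hidx : B.IsIndexable) (ν : ℝ) :
    ∃ (g : ℝ) (h : Fin d → ℝ), (∀ a i, B.bellmanResidual ν g h a i ≤ 0) ∧
      (∀ i, ν ≤ B.whittleIndex i → B.bellmanResidual ν g h true i = 0) ∧
      ∀ i, B.whittleIndex i ≤ ν → B.bellmanResidual ν g h false i = 0 := by
  obtain ⟨g, h, hle, hopt⟩ := huni.exists_bellman ν
  refine ⟨g, h, hle, fun i hi => ?_, fun i hi => ?_⟩
  · obtain ⟨π, hπ, ha⟩ := huni.exists_optimal_active hi
    exact ha ▸ hopt π hπ i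
  · obtain ⟨π, hπ, ha⟩ := huni.exists_optimal_passive hidx hi
    exact ha ▸ hopt π hπ i

end SingleBandit

end Bandit

/-! ### The threshold state and Whittle activation. -/

namespace Bandit

open Matrix

section Threshold

variable {d : ℕ} {B : Bandit d}

theorem sum_whittleIndex_le_eq (hinj : Function.Injective B.whittleIndex) (m : Fin d → ℝ)
    (i : Fin d) : ∑ j with B.whittleIndex i ≤ B.whittleIndex j, m j
      = m i + ∑ j with B.whittleIndex i < B.whittleIndex j, m j := by
  rw [← Finset.sum_insert (a := i) (by simp)]
  congr 1
  ext j
  simp only [Finset.mem_filter, Finset.mem_univ, true_and, Finset.mem_insert, le_iff_lt_or_eq,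
    hinj.eq_iff]
  tauto

/-- The threshold state of a nonsingular configuration, and its stability. -/
theorem exists_threshold {α : ℝ} (hα₀ : 0 ≤ α)
    (hα₁ : α ≤ 1) {m : Fin d → ℝ} (hm : m ∈ stdSimplex ℝ (Fin d)) (hsing : ¬ B.IsSingular α m) :
    ∃ i, (∑ j with B.whittleIndex i < B.whittleIndex j, m j ≤ α) ∧
      (α < ∑ j with B.whittleIndex i ≤ B.whittleIndex j, m j) ∧
      ∀ᶠ m' in nhds m, (∑ j with B.whittleIndex i < B.whittleIndex j, m' j ≤ α) ∧
        α ≤ ∑ j with B.whittleIndex i ≤ B.whittleIndex j, m' j := by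
  have hne : ∀ i, ∑ j with B.whittleIndex i ≤ B.whittleIndex j, m j ≠ α :=
    fun i h => hsing ⟨i, h⟩
  have hd : Nonempty (Fin d) := by
    by_contra h
    rw [not_nonempty_iff] at h
    simpa using hm.2
  set S : Finset (Fin d) :=
    {i | α < ∑ j with B.whittleIndex i ≤ B.whittleIndex j, m j} with hS
  have hSne : S.Nonempty := by
    obtain ⟨i, hi⟩ := Finite.exists_min B.whittleIndex
    refine ⟨i, ?_⟩
    have : ∑ j with B.whittleIndex i ≤ B.whittleIndex j, m j = 1 := by
      rw [Finset.filter_true_of_mem fun j _ => hi j, hm.2]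
    have h2 := hne i
    simp only [hS, Finset.mem_filter, Finset.mem_univ, true_and, this] at h2 ⊢
    exact lt_of_le_of_ne hα₁ h2.symm
  -- The threshold is the state of highest index whose upper set has mass exceeding `α`.
  obtain ⟨i, hiS, hmax⟩ := S.exists_max_image B.whittleIndex hSne
  have hi : α < ∑ j with B.whittleIndex i ≤ B.whittleIndex j, m j := by simpa [hS] using hiS
  have hcont : ∀ T : Finset (Fin d), Continuous fun m' : Fin d → ℝ => ∑ j ∈ T, m' j :=
    fun T => continuous_finsetSum _ fun j _ => continuous_apply j
  have hup := (continuous_const (y := α)).continuousAt.eventually_lt (hcont _).continuousAt hi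
  have hlow : (∑ j with B.whittleIndex i < B.whittleIndex j, m j ≤ α) ∧
      ∀ᶠ m' in nhds m, ∑ j with B.whittleIndex i < B.whittleIndex j, m' j ≤ α := by
    -- If no state lies above `i`, the sum is empty and only `0 ≤ α` is known, whence the weak
    -- inequality. Otherwise it is the upper-set mass of the next state `k`, at most `α` by the
    -- choice of `i` and different from `α` by nonsingularity.
    rcases (Finset.univ.filter fun j => B.whittleIndex i < B.whittleIndex j).eq_empty_or_nonempty
      with he | hne'
    · rw [he]
      simp [hα₀]
    · obtain ⟨k, hk, hmin⟩ := Finset.exists_min_image _ B.whittleIndex hne'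
      simp only [Finset.mem_filter, Finset.mem_univ, true_and] at hk hmin
      have hfilter : (Finset.univ.filter fun j => B.whittleIndex i < B.whittleIndex j)
          = Finset.univ.filter fun j => B.whittleIndex k ≤ B.whittleIndex j := by
        ext j
        simp only [Finset.mem_filter, Finset.mem_univ, true_and]
        exact ⟨hmin j, fun h => hk.trans_le h⟩
      have hkS : k ∉ S := fun h => absurd (hmax k h) (not_le.mpr hk)
      have hlt : ∑ j with B.whittleIndex i < B.whittleIndex j, m j < α := by
        rw [hfilter]
        refine lt_of_le_of_ne (not_lt.mp ?_) (hne k)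
        simpa [hS] using hkS
      exact ⟨hlt.le, ((hcont _).continuousAt.eventually_lt
        (continuous_const (y := α)).continuousAt hlt).mono fun _ h => h.le⟩
  exact ⟨i, hlow.1, hi, hlow.2.and (hup.mono fun _ h => h.le)⟩

/-- The Whittle activation at a configuration as a randomized threshold policy. -/
theorem exists_threshold_policy (hinj : Function.Injective B.whittleIndex) {α : ℝ}
    {m : Fin d → ℝ} (hm : ∀ j, 0 ≤ m j) {i : Fin d}
    (hlow : ∑ j with B.whittleIndex i < B.whittleIndex j, m j ≤ α)
    (hup : α < ∑ j with B.whittleIndex i ≤ B.whittleIndex j, m j) :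
    ∃ θ : Fin d → ℝ, (∀ j, 0 ≤ θ j) ∧ (∀ j, θ j ≤ 1) ∧
      (∀ j, B.activeMass α m j = m j * θ j) ∧ (∑ j, m j * θ j = α) ∧
      (∀ j, B.whittleIndex j < B.whittleIndex i → θ j = 0) ∧
      ∀ j, B.whittleIndex i < B.whittleIndex j → θ j = 1 := by
  set l := ∑ j with B.whittleIndex i < B.whittleIndex j, m j with hl
  have hup' := hup
  rw [sum_whittleIndex_le_eq hinj, ← hl] at hup'
  have hmi : 0 < m i := by linarith
  set q := (α - l) / m i with hq
  have hq0 : 0 ≤ q := div_nonneg (by linarith) hmi.le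
  have hq1 : q ≤ 1 := (div_le_one hmi).mpr (by linarith)
  have hqm : m i * q = α - l := mul_div_cancel₀ _ hmi.ne'
  refine ⟨fun j => if B.whittleIndex i < B.whittleIndex j then 1 else if j = i then q else 0,
    fun j => by dsimp only; split_ifs <;> linarith, fun j => by dsimp only; split_ifs <;> linarith,
    fun j => ?_, ?_, fun j hj => ?_, fun j hj => if_pos hj⟩
  · dsimp only
    rcases lt_trichotomy (B.whittleIndex i) (B.whittleIndex j) with h | h | h
    · rw [if_pos h, mul_one]
      refine min_eq_left (le_max_of_le_right ?_)
      have : ∑ k with B.whittleIndex j ≤ B.whittleIndex k, m k ≤ l :=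
        Finset.sum_le_sum_of_subset_of_nonneg
          (Finset.monotone_filter_right _ fun k _ hk => h.trans_le hk) fun k _ _ => hm k
      rw [sum_whittleIndex_le_eq hinj] at this
      linarith
    · obtain rfl := hinj h
      rw [if_neg (lt_irrefl _), if_pos rfl, hqm, activeMass, ← hl, max_eq_right (by linarith),
        min_eq_right (by linarith)]
    · rw [if_neg h.not_gt, if_neg fun e => h.ne (congrArg _ e), mul_zero]
      have : ∑ k with B.whittleIndex i ≤ B.whittleIndex k, m k
          ≤ ∑ k with B.whittleIndex j < B.whittleIndex k, m k :=
        Finset.sum_le_sum_of_subset_of_nonneg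
          (Finset.monotone_filter_right _ fun k _ hk => h.trans_le hk) fun k _ _ => hm k
      rw [activeMass, max_eq_left (by linarith), min_eq_right (hm j)]
  · have : ∀ j, m j * (if B.whittleIndex i < B.whittleIndex j then 1 else if j = i then q else 0)
        = (if B.whittleIndex i < B.whittleIndex j then m j else 0)
          + if j = i then m i * q else 0 := by
      intro j
      by_cases h : j = i
      · subst h; simp
      · simp [h]
    rw [Finset.sum_congr rfl fun j _ => this j, Finset.sum_add_distrib, ← Finset.sum_filter, ← hl,
      Finset.sum_ite_eq' Finset.univ i, if_pos (Finset.mem_univ i), hqm]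
    ring
  · dsimp only
    rw [if_neg hj.not_gt, if_neg fun e => hj.ne (congrArg _ e)]

end Threshold

/-! ### Configurations of `N` bandits and Whittle actions. -/

section Configuration

variable {d N : ℕ} {B : Bandit d}

/-- The empirical distribution of the states of the `N` bandits. -/
noncomputable def config (s : Fin N → Fin d) (i : Fin d) : ℝ :=
  (Finset.univ.filter fun n => s n = i).card / N

theorem mul_sum_config (hN : 0 < N) (s : Fin N → Fin d) (p : Fin d → Prop) [DecidablePred p] :
    N * ∑ j with p j, config s j = (Finset.univ.filter fun n => p (s n)).card := by
  have hN' : (N : ℝ) ≠ 0 := by positivity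
  rw [Finset.mul_sum]
  simp only [config, mul_div_cancel₀ _ hN']
  norm_cast
  rw [Finset.card_eq_sum_card_fiberwise (f := s) (t := Finset.univ.filter p)
    (fun n hn => by simpa using hn)]
  refine Finset.sum_congr rfl fun j hj => ?_
  congr 1
  ext n
  simp only [Finset.mem_filter, Finset.mem_univ, true_and] at hj ⊢
  constructor
  · rintro rfl; exact ⟨hj, rfl⟩
  · exact fun h => h.2

theorem config_mem_stdSimplex (hN : 0 < N) (s : Fin N → Fin d) :
    config s ∈ stdSimplex ℝ (Fin d) := by
  refine ⟨fun i => div_nonneg (by positivity) (by positivity), ?_⟩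
  have h := mul_sum_config hN s fun _ => True
  simp only [Finset.filter_true, Finset.card_univ, Fintype.card_fin] at h
  have hN' : (N : ℝ) ≠ 0 := by positivity
  exact mul_left_cancel₀ hN' (h.trans (mul_one _).symm)

/-- The action vectors a Whittle index policy may use in the state vector `s`. -/
def IsWhittleAction (B : Bandit d) (α : ℝ) (s : Fin N → Fin d) (a : Fin N → Bool) : Prop :=
  ((Finset.univ.filter fun n => a n = true).card : ℝ) = α * N ∧
    ∀ n n', a n = true → a n' = false → B.whittleIndex (s n') ≤ B.whittleIndex (s n)

/-- The formula for `activeMass` is exact at configurations because `α N` is the integer number of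
active bandits. Hence the choice among bandits in the same state does not affect the activated
counts. -/
theorem IsWhittleAction.mul_activeMass_config (hinj : Function.Injective B.whittleIndex) {α : ℝ}
    (hN : 0 < N) {s : Fin N → Fin d} {a : Fin N → Bool} (ha : B.IsWhittleAction α s a)
    (i : Fin d) : N * B.activeMass α (config s) i
      = (Finset.univ.filter fun n => s n = i ∧ a n = true).card := by
  have hN' : (0 : ℝ) < N := by positivity
  set A := (Finset.univ.filter fun n => a n = true).card with hA
  set c := (Finset.univ.filter fun n => s n = i).card with hc
  set ci := (Finset.univ.filter fun n => s n = i ∧ a n = true).card with hci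
  set b := (Finset.univ.filter fun n => B.whittleIndex i < B.whittleIndex (s n)).card with hb
  set ba := (Finset.univ.filter fun n =>
    B.whittleIndex i < B.whittleIndex (s n) ∧ a n = true).card with hba
  have h1 : ci ≤ c := Finset.card_le_card
    (Finset.monotone_filter_right _ fun n _ h => h.1)
  have h2 : ba ≤ b := Finset.card_le_card
    (Finset.monotone_filter_right _ fun n _ h => h.1)
  have hunion : ci + ba = (Finset.univ.filter fun n =>
      a n = true ∧ B.whittleIndex i ≤ B.whittleIndex (s n)).card := by
    rw [hci, hba, ← Finset.card_union_of_disjoint]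
    · congr 1
      ext n
      simp only [Finset.mem_union, Finset.mem_filter, Finset.mem_univ, true_and, le_iff_lt_or_eq,
        hinj.eq_iff, eq_comm (a := i)]
      tauto
    · rw [Finset.disjoint_filter]
      rintro n - ⟨rfl, -⟩ ⟨h, -⟩
      exact lt_irrefl _ h
  have h3 : ci + ba ≤ A := by
    rw [hunion]
    exact Finset.card_le_card (Finset.monotone_filter_right _ fun n _ h => h.1)
  -- A passive bandit in state `i` excludes active bandits of smaller index.
  have h4 : ci < c → A ≤ ci + ba := by
    intro h
    obtain ⟨n, hn, hn'⟩ := Finset.exists_mem_notMem_of_card_lt_card h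
    simp only [Finset.mem_filter, Finset.mem_univ, true_and] at hn hn'
    rw [hunion]
    refine Finset.card_le_card (Finset.monotone_filter_right _ fun n' _ h' => ⟨h', ?_⟩)
    subst hn
    exact ha.2 n' n h' (by simpa using hn')
  -- An active bandit in state `i` forces every bandit of larger index to be active.
  have h5 : 0 < ci → b ≤ ba := by
    intro h
    obtain ⟨n, hn⟩ := Finset.card_pos.mp h
    simp only [Finset.mem_filter, Finset.mem_univ, true_and] at hn
    obtain ⟨rfl, hn⟩ := hn
    refine Finset.card_le_card (Finset.monotone_filter_right _ fun n' _ h' => ⟨h', ?_⟩)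
    by_contra hf
    exact absurd (ha.2 n n' hn (by simpa using hf)) (not_le.mpr h')
  have key : (ci : ℝ) = min (c : ℝ) (max 0 ((A : ℝ) - b)) := by
    have : ci = min c (A - b) := by omega
    rcases le_total b A with h | h
    · rw [max_eq_right (by rw [sub_nonneg]; exact_mod_cast h), this]
      push_cast [Nat.cast_sub h]
      rfl
    · have h0 : ci = 0 := by omega
      rw [max_eq_left (by rw [sub_nonpos]; exact_mod_cast h), h0, min_eq_right (by positivity)]
      simp
  rw [key, activeMass, mul_min_of_nonneg _ _ hN'.le, mul_max_of_nonneg _ _ hN'.le, mul_zero,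
    mul_sub, mul_sum_config hN s, mul_comm _ α, ← ha.1, config, mul_div_cancel₀ _ hN'.ne']

/-- Were a bandit above the threshold passive, the active bandits would form a proper subset of
those above it, which number at most `α N`. The other case is dual. -/
theorem IsWhittleAction.eq_of_threshold {α : ℝ} (hN : 0 < N) {s : Fin N → Fin d}
    {a : Fin N → Bool} (ha : B.IsWhittleAction α s a) {i : Fin d}
    (hlow : ∑ j with B.whittleIndex i < B.whittleIndex j, config s j ≤ α)
    (hup : α ≤ ∑ j with B.whittleIndex i ≤ B.whittleIndex j, config s j) (n : Fin N) :
    (B.whittleIndex i < B.whittleIndex (s n) → a n = true) ∧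
      (B.whittleIndex (s n) < B.whittleIndex i → a n = false) := by
  have hN' : (0 : ℝ) < N := by positivity
  have hlow' := mul_le_mul_of_nonneg_left hlow hN'.le
  have hup' := mul_le_mul_of_nonneg_left hup hN'.le
  rw [mul_sum_config hN s, mul_comm _ α, ← ha.1, Nat.cast_le] at hlow' hup'
  constructor
  · intro h
    by_contra hn
    rw [Bool.not_eq_true] at hn
    refine absurd hlow' (not_le.mpr (Finset.card_lt_card ?_))
    refine (Finset.ssubset_iff_of_subset ?_).mpr ⟨n, by simp [h], by simp [hn]⟩
    exact Finset.monotone_filter_right _ fun n' _ h' => h.trans_le (ha.2 n' n h' hn)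
  · intro h
    by_contra hn
    rw [Bool.not_eq_false] at hn
    refine absurd hup' (not_le.mpr (Finset.card_lt_card ?_))
    refine (Finset.ssubset_iff_of_subset ?_).mpr ⟨n, by simp [hn], by simp [h]⟩
    refine Finset.monotone_filter_right _ fun n' _ h' => ?_
    by_contra hf
    exact absurd (ha.2 n n' hn (by simpa using hf)) (not_le.mpr (h.trans_le h'))

theorem exists_isWhittleAction (B : Bandit d) {α : ℝ} (hα₁ : α ≤ 1) {k : ℕ} (hk : α * N = k)
    (s : Fin N → Fin d) : ∃ a, B.IsWhittleAction α s a := by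
  have hkN : k ≤ N := by
    have : (k : ℝ) ≤ N := by
      rw [← hk]
      exact mul_le_of_le_one_left (by positivity) hα₁
    exact_mod_cast this
  have htop : ∀ k ≤ N, ∃ A : Finset (Fin N), A.card = k ∧
      ∀ n ∈ A, ∀ n' ∉ A, B.whittleIndex (s n') ≤ B.whittleIndex (s n) := by
    intro k
    induction k with
    | zero => exact fun _ => ⟨∅, by simp⟩
    | succ k ih =>
      intro hk
      obtain ⟨A, hA, hord⟩ := ih (by omega)
      have hne : Aᶜ.Nonempty := by
        rw [← Finset.card_pos, Finset.card_compl, Fintype.card_fin]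
        omega
      obtain ⟨m, hm, hmax⟩ := Aᶜ.exists_max_image (fun n => B.whittleIndex (s n)) hne
      rw [Finset.mem_compl] at hm
      refine ⟨insert m A, by rw [Finset.card_insert_of_notMem hm, hA], fun n hn n' hn' => ?_⟩
      rw [Finset.mem_insert, not_or] at hn'
      rcases Finset.mem_insert.mp hn with rfl | hn
      · exact hmax n' (Finset.mem_compl.mpr hn'.2)
      · exact hord n hn n' hn'.2
  obtain ⟨A, hA, hord⟩ := htop k hkN
  refine ⟨fun n => decide (n ∈ A), ?_, fun n n' hn hn' => ?_⟩
  · simp [hk, hA]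
  · exact hord n (by simpa using hn) n' (by simpa using hn')

theorem exists_isWhittlePolicy (B : Bandit d) {α : ℝ} (hα₁ : α ≤ 1) {k : ℕ} (hk : α * N = k) :
    ∃ π : Policy d N, B.IsWhittlePolicy α π := by
  choose a ha using B.exists_isWhittleAction hα₁ hk
  refine ⟨fun s => ⟨Pi.single (a s) 1, single_mem_stdSimplex ℝ (a s)⟩, fun s b hb => ?_⟩
  have : b = a s := by
    by_contra h
    exact hb (Pi.single_eq_of_ne h 1)
  exact this ▸ ha s

end Configuration

end Bandit

/-! ### The joint chain and its residual decomposition. -/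

namespace Bandit

open Matrix

section ProductMeasure

variable {N : ℕ} {ι : Type*} [Fintype ι]

theorem sum_prod_eq_one {q : Fin N → ι → ℝ} (hq : ∀ n, ∑ i, q n i = 1) :
    ∑ f : Fin N → ι, ∏ n, q n (f n) = 1 := by
  have h := Finset.prod_univ_sum (fun _ : Fin N => (Finset.univ : Finset ι)) q
  rw [Fintype.piFinset_univ] at h
  rw [← h]
  simp [hq]

theorem sum_prod_mul_apply {q : Fin N → ι → ℝ} (hq : ∀ n, ∑ i, q n i = 1) (F : ι → ℝ)
    (m : Fin N) : ∑ f : Fin N → ι, (∏ n, q n (f n)) * F (f m) = ∑ i, q m i * F i := by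
  have h := Finset.prod_univ_sum (fun _ : Fin N => (Finset.univ : Finset ι))
    fun n i => q n i * if n = m then F i else 1
  rw [Fintype.piFinset_univ] at h
  simp only [Finset.prod_mul_distrib, Finset.prod_ite_eq', Finset.mem_univ, if_true] at h
  rw [← h, Finset.prod_eq_single m]
  · simp
  · intro n _ hn
    simp [hn, hq]
  · simp

theorem sum_prod_mul_sum {q : Fin N → ι → ℝ} (hq : ∀ n, ∑ i, q n i = 1)
    (F : Fin N → ι → ℝ) : ∑ f : Fin N → ι, (∏ n, q n (f n)) * ∑ m, F m (f m)
      = ∑ m, ∑ i, q m i * F m i := by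
  simp only [Finset.mul_sum]
  rw [Finset.sum_comm]
  exact Finset.sum_congr rfl fun m _ => sum_prod_mul_apply hq (F m) m

end ProductMeasure

section JointChain

variable {d N : ℕ} {B : Bandit d}

theorem jointMatrix_mulVec (B : Bandit d) (π : Policy d N) (F : (Fin N → Fin d) → ℝ)
    (s : Fin N → Fin d) : (B.jointMatrix π *ᵥ F) s
      = ∑ a, (π s).1 a * ∑ s', (∏ n, B.P (a n) (s n) (s' n)) * F s' := by
  simp only [mulVec, dotProduct, jointMatrix, Matrix.of_apply, Finset.sum_mul, Finset.mul_sum,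
    mul_assoc]
  exact Finset.sum_comm

theorem jointMatrix_mem (B : Bandit d) (π : Policy d N) :
    B.jointMatrix π ∈ rowStochastic ℝ (Fin N → Fin d) := by
  refine ⟨fun s s' => Finset.sum_nonneg fun a _ => mul_nonneg ((π s).2.1 a)
    (Finset.prod_nonneg fun n _ => (B.stochastic (a n)).1 _ _), ?_⟩
  ext s
  rw [jointMatrix_mulVec]
  simp only [Pi.one_apply, mul_one]
  rw [Finset.sum_congr rfl fun a _ => by
    rw [sum_prod_eq_one fun n => sum_row_of_mem_rowStochastic (B.stochastic (a n)) (s n), mul_one]]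
  exact (π s).2.2

theorem jointMatrix_mulVec_sum (B : Bandit d) (π : Policy d N) (h : Fin d → ℝ)
    (s : Fin N → Fin d) : (B.jointMatrix π *ᵥ fun s => ∑ n, h (s n)) s
      = ∑ a, (π s).1 a * ∑ n, (B.P (a n) *ᵥ h) (s n) := by
  rw [jointMatrix_mulVec]
  refine Finset.sum_congr rfl fun a _ => ?_
  rw [sum_prod_mul_sum (fun n => sum_row_of_mem_rowStochastic (B.stochastic (a n)) (s n))
    fun _ => h]
  rfl

/-- Expected total residual of the `N` bandits in state vector `s` under `π`. -/
def jointResidual (B : Bandit d) (ν g : ℝ) (h : Fin d → ℝ) (π : Policy d N)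
    (s : Fin N → Fin d) : ℝ :=
  ∑ a, (π s).1 a * ∑ n, B.bellmanResidual ν g h (a n) (s n)

/-- The bias of the system is the sum of the individual biases. The subsidy is paid to the passive
bandits, `N` minus the active ones, whence the constant `N (g - ν)` and the coefficient `ν` of
`jointActive`. -/
theorem jointReward_eq (ν g : ℝ) (h : Fin d → ℝ) (π : Policy d N) :
    B.jointReward π = (fun _ => N * (g - ν)) + ν • jointActive π
      + ((fun s => ∑ n, h (s n)) - B.jointMatrix π *ᵥ fun s => ∑ n, h (s n))
      + B.jointResidual ν g h π := by
  ext s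
  have h1 : ∀ c : ℝ, c = ∑ a, (π s).1 a * c := fun c => by
    rw [← Finset.sum_mul, (π s).2.2, one_mul]
  simp only [Pi.add_apply, Pi.sub_apply, Pi.smul_apply, smul_eq_mul, jointMatrix_mulVec_sum]
  rw [h1 (N * (g - ν)), h1 (∑ n, h (s n)), jointActive, jointResidual, jointReward, Finset.mul_sum,
    ← Finset.sum_sub_distrib, ← Finset.sum_add_distrib, ← Finset.sum_add_distrib,
    ← Finset.sum_add_distrib]
  refine Finset.sum_congr rfl fun a _ => ?_
  have key : ∑ n, B.R (a n) (s n) = N * (g - ν) + ν * (∑ n, if a n = true then 1 else 0)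
      + (∑ n, h (s n) - ∑ n, (B.P (a n) *ᵥ h) (s n))
      + ∑ n, B.bellmanResidual ν g h (a n) (s n) := by
    have h2 : (N : ℝ) * (g - ν) = ∑ _n : Fin N, (g - ν) := by
      rw [Finset.sum_const, Finset.card_univ, Fintype.card_fin, nsmul_eq_mul]
    rw [h2, Finset.mul_sum, ← Finset.sum_sub_distrib, ← Finset.sum_add_distrib,
      ← Finset.sum_add_distrib, ← Finset.sum_add_distrib]
    refine Finset.sum_congr rfl fun n _ => ?_
    unfold bellmanResidual
    cases a n <;> simp <;> ring
  rw [key]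
  ring

theorem hasLongRunAverage_expectedReward {ν g A l : ℝ} {h : Fin d → ℝ} {π : Policy d N}
    {s : Fin N → Fin d} (hA : HasLongRunAverage (B.expectedActive π s) A)
    (hl : HasLongRunAverage (fun t => (B.jointMatrix π ^ t *ᵥ B.jointResidual ν g h π) s) l) :
    HasLongRunAverage (B.expectedReward π s) (N * (g - ν) + ν * A + l) := by
  have hQ := B.jointMatrix_mem π
  have h1 := hasLongRunAverage_of_poisson hQ (g := N * (g - ν))
    (h := fun s => ∑ n, h (s n)) rfl s
  convert ((h1.add (hA.const_mul ν)).add hl) using 2 with t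
  rw [expectedReward, jointReward_eq ν g h π, expectedActive]
  simp only [mulVec_add, mulVec_smul, Pi.add_apply, Pi.smul_apply, smul_eq_mul]
  ring

theorem jointResidual_nonpos {ν g : ℝ} {h : Fin d → ℝ}
    (hle : ∀ a i, B.bellmanResidual ν g h a i ≤ 0) (π : Policy d N) (s : Fin N → Fin d) :
    B.jointResidual ν g h π s ≤ 0 :=
  Finset.sum_nonpos fun a _ => mul_nonpos_of_nonneg_of_nonpos ((π s).2.1 a)
    (Finset.sum_nonpos fun n _ => hle (a n) (s n))

theorem longRunAverage_jointResidual_nonpos {ν g l : ℝ} {h : Fin d → ℝ}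
    (hle : ∀ a i, B.bellmanResidual ν g h a i ≤ 0) {π : Policy d N} {s : Fin N → Fin d}
    (hl : HasLongRunAverage (fun t => (B.jointMatrix π ^ t *ᵥ B.jointResidual ν g h π) s) l) :
    l ≤ 0 := by
  have hneg : ∀ t, (B.jointMatrix π ^ t *ᵥ B.jointResidual ν g h π) s ≤ 0 := fun t => by
    have := mulVec_mono_of_mem_rowStochastic (pow_mem (B.jointMatrix_mem π) t)
      (v := fun _ => (0 : ℝ)) (jointResidual_nonpos hle π) s
    rwa [mulVec_const_of_mem_rowStochastic (pow_mem (B.jointMatrix_mem π) t)] at this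
  exact hl.le_of_eventually_le (T₀ := 0) le_rfl hneg fun t _ => hneg t

end JointChain

/-! ### The relaxed problem. -/

section Relaxed

variable {d N : ℕ} {B : Bandit d}

/-- Transition matrix of one bandit that is activated in state `i` with probability `θ i`. -/
def mixedMatrix (B : Bandit d) (θ : Fin d → ℝ) : Matrix (Fin d) (Fin d) ℝ :=
  Matrix.of fun i j => θ i * B.P true i j + (1 - θ i) * B.P false i j

theorem mixedMatrix_mulVec (B : Bandit d) (θ h : Fin d → ℝ) (i : Fin d) :
    (B.mixedMatrix θ *ᵥ h) i
      = θ i * (B.P true *ᵥ h) i + (1 - θ i) * (B.P false *ᵥ h) i := by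
  simp only [mulVec, dotProduct, mixedMatrix, Matrix.of_apply, Finset.mul_sum,
    ← Finset.sum_add_distrib]
  exact Finset.sum_congr rfl fun j _ => by ring

theorem mixedMatrix_mem (B : Bandit d) {θ : Fin d → ℝ} (h0 : ∀ i, 0 ≤ θ i) (h1 : ∀ i, θ i ≤ 1) :
    B.mixedMatrix θ ∈ rowStochastic ℝ (Fin d) := by
  refine ⟨fun i j => add_nonneg (mul_nonneg (h0 i) ((B.stochastic true).1 i j))
    (mul_nonneg (sub_nonneg.mpr (h1 i)) ((B.stochastic false).1 i j)), ?_⟩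
  ext i
  rw [mixedMatrix_mulVec, (B.stochastic true).2, (B.stochastic false).2]
  simp

/-- The deterministic policy that is active exactly where `θ` is positive uses only transitions that
the mixed chain also allows. -/
theorem IsUnichain.mixedMatrix_statesCommunicate (huni : B.IsUnichain) {θ : Fin d → ℝ}
    (h0 : ∀ i, 0 ≤ θ i) (h1 : ∀ i, θ i ≤ 1) : (B.mixedMatrix θ).StatesCommunicate := by
  set π : Fin d → Bool := fun i => decide (0 < θ i) with hπ
  have hM := B.mixedMatrix_mem h0 h1
  have hstep : ∀ i j, 0 < B.policyMatrix π i j → 0 < B.mixedMatrix θ i j := by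
    intro i j hij
    simp only [policyMatrix, mixedMatrix, Matrix.of_apply, hπ] at hij ⊢
    by_cases h : 0 < θ i
    · rw [decide_eq_true h] at hij
      exact add_pos_of_pos_of_nonneg (mul_pos h hij)
        (mul_nonneg (sub_nonneg.mpr (h1 i)) ((B.stochastic false).1 i j))
    · rw [decide_eq_false h] at hij
      have : θ i = 0 := le_antisymm (not_lt.mp h) (h0 i)
      simpa [this] using hij
  have hpow : ∀ k i j, 0 < (B.policyMatrix π ^ k) i j → 0 < (B.mixedMatrix θ ^ k) i j := by
    intro k
    induction k with
    | zero => simp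
    | succ k ih =>
      intro i j hij
      rw [pow_succ, mul_apply] at hij ⊢
      have hnn : ∀ l ∈ Finset.univ, 0 ≤ (B.mixedMatrix θ ^ k) i l * B.mixedMatrix θ l j :=
        fun l _ => mul_nonneg ((pow_mem hM k).1 i l) (hM.1 l j)
      obtain ⟨l, -, hl⟩ := Finset.exists_lt_of_sum_lt (s := Finset.univ)
        (f := fun _ : Fin d => (0 : ℝ)) (by simpa using hij)
      have hQk := (pow_mem (B.policyMatrix_mem π) k).1 i l
      refine Finset.sum_pos' hnn ⟨l, Finset.mem_univ l, mul_pos (ih i l ?_) (hstep l j ?_)⟩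
      · exact pos_of_mul_pos_left hl ((B.policyMatrix_mem π).1 l j)
      · exact pos_of_mul_pos_right hl hQk
  intro i j
  obtain ⟨k, hk⟩ := (huni π).1 i j
  exact ⟨k, hpow k i j hk⟩

/-- The policy that activates each bandit independently, with probability `θ i` in state `i`. -/
noncomputable def productPolicy (N : ℕ) {θ : Fin d → ℝ} (h0 : ∀ i, 0 ≤ θ i) (h1 : ∀ i, θ i ≤ 1) :
    Policy d N := fun s =>
  ⟨fun a => ∏ n, if a n = true then θ (s n) else 1 - θ (s n),
    fun a => Finset.prod_nonneg fun n _ => by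
      split_ifs
      exacts [h0 _, sub_nonneg.mpr (h1 _)],
    sum_prod_eq_one (q := fun n (b : Bool) => if b = true then θ (s n) else 1 - θ (s n))
      fun n => by simp⟩

theorem sum_productPolicy_mul_sum {θ : Fin d → ℝ} (h0 : ∀ i, 0 ≤ θ i) (h1 : ∀ i, θ i ≤ 1)
    (F : Bool → Fin d → ℝ) (s : Fin N → Fin d) :
    ∑ a, (productPolicy N h0 h1 s).1 a * ∑ n, F (a n) (s n)
      = ∑ n, (θ (s n) * F true (s n) + (1 - θ (s n)) * F false (s n)) := by
  have := sum_prod_mul_sum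
    (q := fun n (b : Bool) => if b = true then θ (s n) else 1 - θ (s n))
    (fun n => by simp) fun n b => F b (s n)
  simpa [productPolicy] using this

/-- The one-bandit Poisson equation for `θ` sums to one for the joint chain; pairing it with the
stationary `m` identifies the gain. -/
theorem IsUnichain.hasLongRunAverage_productPolicy (huni : B.IsUnichain) {θ m : Fin d → ℝ}
    (h0 : ∀ i, 0 ≤ θ i) (h1 : ∀ i, θ i ≤ 1) (hm : ∑ i, m i = 1)
    (hstat : m ᵥ* B.mixedMatrix θ = m) (s : Fin N → Fin d) :
    HasLongRunAverage (B.expectedActive (productPolicy N h0 h1) s) ((∑ j, m j * θ j) * N) := by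
  obtain ⟨c, y, hy⟩ := (huni.mixedMatrix_statesCommunicate h0 h1).exists_poisson
    (B.mixedMatrix_mem h0 h1) θ
  have hc : ∑ j, m j * θ j = c := by
    change m ⬝ᵥ θ = c
    have h3 : m ⬝ᵥ (fun _ => c) = c := by simp [dotProduct, ← Finset.sum_mul, hm]
    rw [hy, dotProduct_add, dotProduct_sub, dotProduct_mulVec, hstat, sub_self, add_zero, h3]
  rw [hc]
  refine hasLongRunAverage_of_poisson (B.jointMatrix_mem _) (h := fun s => ∑ n, y (s n)) ?_ s
  ext s
  have h2 : ∀ i, θ i * 1 + (1 - θ i) * 0 = c + (y i - (B.mixedMatrix θ *ᵥ y) i) := by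
    intro i
    rw [mul_one, mul_zero, add_zero]
    exact congrFun hy i
  simp only [Pi.add_apply, Pi.sub_apply, jointMatrix_mulVec_sum, jointActive]
  rw [sum_productPolicy_mul_sum h0 h1 (fun b _ => if b = true then (1 : ℝ) else 0),
    sum_productPolicy_mul_sum h0 h1 (fun b => B.P b *ᵥ y)]
  simp only [if_true, Bool.false_eq_true, if_false, h2, mixedMatrix_mulVec,
    Finset.sum_add_distrib, Finset.sum_sub_distrib, Finset.sum_const, Finset.card_univ,
    Fintype.card_fin, nsmul_eq_mul]
  ring

/-- The value of the relaxed problem, by Lagrangian duality. -/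
theorem IsUnichain.isRelaxedValue (huni : B.IsUnichain) {ν g α : ℝ} {h θ m : Fin d → ℝ}
    (hle : ∀ a i, B.bellmanResidual ν g h a i ≤ 0)
    (h0 : ∀ i, 0 ≤ θ i) (h1 : ∀ i, θ i ≤ 1) (hm : ∑ i, m i = 1)
    (hstat : m ᵥ* B.mixedMatrix θ = m) (hα : ∑ j, m j * θ j = α)
    (hact : ∀ i, θ i ≠ 0 → B.bellmanResidual ν g h true i = 0)
    (hpas : ∀ i, θ i ≠ 1 → B.bellmanResidual ν g h false i = 0) (N : ℕ) :
    B.IsRelaxedValue α N (N * (g - ν) + ν * (α * N)) := by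
  intro s
  refine IsGreatest.isLUB ⟨⟨productPolicy N h0 h1, ?_, ?_⟩, ?_⟩
  · exact hα ▸ huni.hasLongRunAverage_productPolicy h0 h1 hm hstat s
  -- Complementary slackness: each action taken with positive probability has zero residual.
  · have hres : B.jointResidual ν g h (productPolicy N h0 h1) = 0 := by
      ext s
      rw [jointResidual, sum_productPolicy_mul_sum h0 h1]
      refine Finset.sum_eq_zero fun n _ => ?_
      have e1 : θ (s n) * B.bellmanResidual ν g h true (s n) = 0 := by
        by_cases hz : θ (s n) = 0
        · rw [hz, zero_mul]
        · rw [hact _ hz, mul_zero]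
      have e2 : (1 - θ (s n)) * B.bellmanResidual ν g h false (s n) = 0 := by
        by_cases hz : θ (s n) = 1
        · rw [hz, sub_self, zero_mul]
        · rw [hpas _ hz, mul_zero]
      rw [e1, e2, add_zero]
    have := hasLongRunAverage_expectedReward (B := B) (ν := ν) (g := g) (h := h) (l := 0)
      (hα ▸ huni.hasLongRunAverage_productPolicy h0 h1 hm hstat s) (by
        rw [hres]
        simpa using HasLongRunAverage.const 0)
    rwa [add_zero] at this
  · rintro v ⟨π, hA, hv⟩
    obtain ⟨l, hl⟩ := exists_hasLongRunAverage (B.jointMatrix_mem π)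
      (B.jointResidual ν g h π) s
    rw [hv.unique (hasLongRunAverage_expectedReward hA hl)]
    linarith [longRunAverage_jointResidual_nonpos hle hl]

end Relaxed

end Bandit

/-! ### Concentration around the mean-field dynamics. -/

namespace Bandit

open Matrix

section Concentration

/-- Exponential tail bound for a sum of independent centred variables bounded by one. -/
theorem sum_prod_filter_le_exp {N : ℕ} {ι : Type*} [Fintype ι] {q Y : Fin N → ι → ℝ}
    (hq0 : ∀ n i, 0 ≤ q n i) (hq : ∀ n, ∑ i, q n i = 1) (hY : ∀ n i, |Y n i| ≤ 1)
    (hcent : ∀ n, ∑ i, q n i * Y n i = 0) {δ : ℝ} (hδ0 : 0 ≤ δ) (hδ : δ ≤ 1) :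
    ∑ f : Fin N → ι with N * δ ≤ ∑ n, Y n (f n), ∏ n, q n (f n)
      ≤ Real.exp (-(δ ^ 2 / 4) * N) := by
  -- This minimizes the Chernoff exponent `l ^ 2 - l * δ`. The term `l ^ 2` comes from `exp x ≤ 1 +
  -- x + x ^ 2` for `|x| ≤ 1`, centring removing the linear term.
  set l := δ / 2 with hl
  have hl0 : 0 ≤ l := by positivity
  have hl1 : l ≤ 1 := by linarith
  have hone : ∀ n, ∑ i, q n i * Real.exp (l * Y n i) ≤ Real.exp (l ^ 2) := by
    intro n
    have hpt : ∀ i ∈ Finset.univ, q n i * Real.exp (l * Y n i)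
        ≤ q n i * (1 + l ^ 2) + l * (q n i * Y n i) := by
      intro i _
      have hlY : |l * Y n i| ≤ l := by
        rw [abs_mul, abs_of_nonneg hl0]
        exact mul_le_of_le_one_right hl0 (hY n i)
      have h1 := (abs_le.mp (Real.abs_exp_sub_one_sub_id_le (hlY.trans hl1))).2
      have h2 : (l * Y n i) ^ 2 ≤ l ^ 2 := sq_le_sq' (abs_le.mp hlY).1 (abs_le.mp hlY).2
      have h3 := mul_le_mul_of_nonneg_left
        (show Real.exp (l * Y n i) ≤ 1 + l ^ 2 + l * Y n i by linarith) (hq0 n i)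
      linarith
    refine (Finset.sum_le_sum hpt).trans ?_
    rw [Finset.sum_add_distrib, ← Finset.sum_mul, ← Finset.mul_sum, hq, hcent]
    linarith [Real.add_one_le_exp (l ^ 2)]
  have hmgf : ∑ f : Fin N → ι, (∏ n, q n (f n)) * Real.exp (l * ∑ n, Y n (f n))
      ≤ Real.exp (l ^ 2) ^ N := by
    have h := Finset.prod_univ_sum (fun _ : Fin N => (Finset.univ : Finset ι))
      fun n i => q n i * Real.exp (l * Y n i)
    rw [Fintype.piFinset_univ] at h
    simp only [Finset.mul_sum, Real.exp_sum, ← Finset.prod_mul_distrib]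
    rw [← h]
    refine (Finset.prod_le_prod (fun n _ => Finset.sum_nonneg fun i _ =>
      mul_nonneg (hq0 n i) (Real.exp_nonneg _)) fun n _ => hone n).trans ?_
    simp
  calc ∑ f : Fin N → ι with N * δ ≤ ∑ n, Y n (f n), ∏ n, q n (f n)
      ≤ ∑ f : Fin N → ι, (∏ n, q n (f n)) * Real.exp (l * ∑ n, Y n (f n))
          * Real.exp (-(l * (N * δ))) := by
        rw [Finset.sum_filter]
        refine Finset.sum_le_sum fun f _ => ?_
        have hp : 0 ≤ ∏ n, q n (f n) := Finset.prod_nonneg fun n _ => hq0 n (f n)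
        split_ifs with h
        · rw [mul_assoc, ← Real.exp_add]
          refine le_mul_of_one_le_right hp (Real.one_le_exp ?_)
          linarith [mul_le_mul_of_nonneg_left h hl0]
        · positivity
    _ ≤ Real.exp (l ^ 2) ^ N * Real.exp (-(l * (N * δ))) := by
        rw [← Finset.sum_mul]
        gcongr
    _ = Real.exp (-(δ ^ 2 / 4) * N) := by
        rw [← Real.exp_nat_mul, ← Real.exp_add]
        congr 1
        rw [hl]
        ring

variable {d N : ℕ} {B : Bandit d}

theorem activeMass_le (B : Bandit d) (α : ℝ) (m : Fin d → ℝ) (i : Fin d) :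
    B.activeMass α m i ≤ m i := min_le_left _ _

theorem activeMass_nonneg (B : Bandit d) (α : ℝ) {m : Fin d → ℝ} (hm : ∀ i, 0 ≤ m i) (i : Fin d) :
    0 ≤ B.activeMass α m i := le_min (hm i) (le_max_left _ _)

theorem meanField_mem_stdSimplex (B : Bandit d) (α : ℝ) {m : Fin d → ℝ}
    (hm : m ∈ stdSimplex ℝ (Fin d)) : B.meanField α m ∈ stdSimplex ℝ (Fin d) := by
  refine ⟨fun j => Finset.sum_nonneg fun i _ => add_nonneg
    (mul_nonneg (B.activeMass_nonneg α hm.1 i) ((B.stochastic true).1 i j))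
    (mul_nonneg (sub_nonneg.mpr (B.activeMass_le α m i)) ((B.stochastic false).1 i j)), ?_⟩
  unfold meanField
  rw [Finset.sum_comm]
  simp only [Finset.sum_add_distrib, ← Finset.mul_sum,
    sum_row_of_mem_rowStochastic (B.stochastic _), mul_one]
  rw [← Finset.sum_add_distrib, ← hm.2]
  exact Finset.sum_congr rfl fun i _ => by ring

theorem iterate_meanField_mem_stdSimplex (B : Bandit d) (α : ℝ) {m : Fin d → ℝ}
    (hm : m ∈ stdSimplex ℝ (Fin d)) (k : ℕ) : (B.meanField α)^[k] m ∈ stdSimplex ℝ (Fin d) := by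
  induction k with
  | zero => exact hm
  | succ k ih =>
    rw [Function.iterate_succ_apply']
    exact B.meanField_mem_stdSimplex α ih

theorem continuous_meanField (B : Bandit d) (α : ℝ) : Continuous (B.meanField α) := by
  unfold meanField activeMass
  fun_prop

/-- The mean-field map gives the conditional mean of the next configuration without any error,
whichever Whittle action is used. -/
theorem IsWhittleAction.mul_meanField_config (hinj : Function.Injective B.whittleIndex) {α : ℝ}
    (hN : 0 < N) {s : Fin N → Fin d} {a : Fin N → Bool} (ha : B.IsWhittleAction α s a)
    (j : Fin d) : N * B.meanField α (config s) j = ∑ n, B.P (a n) (s n) j := by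
  have hN' : (N : ℝ) ≠ 0 := by positivity
  have h1 : ∀ i, N * B.activeMass α (config s) i
      = ∑ n, if s n = i ∧ a n = true then (1 : ℝ) else 0 := fun i => by
    rw [ha.mul_activeMass_config hinj hN, Finset.sum_boole]
  have h2 : ∀ i, N * config s i = ∑ n, if s n = i then (1 : ℝ) else 0 := fun i => by
    rw [config, mul_div_cancel₀ _ hN', Finset.sum_boole]
  have h3 : ∀ i, N * (B.activeMass α (config s) i * B.P true i j
      + (config s i - B.activeMass α (config s) i) * B.P false i j)
      = ∑ n, if s n = i then B.P (a n) (s n) j else 0 := by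
    intro i
    have : N * (B.activeMass α (config s) i * B.P true i j
        + (config s i - B.activeMass α (config s) i) * B.P false i j)
        = (N * B.activeMass α (config s) i) * B.P true i j
        + (N * config s i - N * B.activeMass α (config s) i) * B.P false i j := by ring
    rw [this, h1, h2, ← Finset.sum_sub_distrib, Finset.sum_mul, Finset.sum_mul,
      ← Finset.sum_add_distrib]
    refine Finset.sum_congr rfl fun n _ => ?_
    by_cases hi : s n = i
    · subst hi
      cases a n <;> simp
    · simp [hi]
  rw [meanField, Finset.mul_sum, Finset.sum_congr rfl fun i _ => h3 i, Finset.sum_comm]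
  simp

/-- Given a Whittle action, the next configuration is close to its mean with high probability. -/
theorem IsWhittleAction.sum_prod_le (hinj : Function.Injective B.whittleIndex) {α : ℝ}
    (hN : 0 < N) {s : Fin N → Fin d} {a : Fin N → Bool} (ha : B.IsWhittleAction α s a)
    {δ : ℝ} (hδ0 : 0 < δ) (hδ : δ ≤ 1) :
    ∑ s' : Fin N → Fin d with δ < ‖config s' - B.meanField α (config s)‖,
      ∏ n, B.P (a n) (s n) (s' n) ≤ 2 * d * Real.exp (-(δ ^ 2 / 4) * N) := by
  have hN' : (0 : ℝ) < N := by positivity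
  -- Centred indicators of a move to `j`; the union over coordinates and signs produces the factor
  -- `2 * d`.
  set Y : Fin d → Fin N → Fin d → ℝ :=
    fun j n i => (if i = j then 1 else 0) - B.P (a n) (s n) j with hYdef
  have hP0 : ∀ n i, 0 ≤ B.P (a n) (s n) i := fun n i => (B.stochastic (a n)).1 _ _
  have hP1 : ∀ n, ∑ i, B.P (a n) (s n) i = 1 :=
    fun n => sum_row_of_mem_rowStochastic (B.stochastic (a n)) _
  have hY : ∀ j n i, |Y j n i| ≤ 1 := by
    intro j n i
    have h0 := hP0 n j
    have h1 := le_one_of_mem_rowStochastic (B.stochastic (a n)) (i := s n) (j := j)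
    change |(if i = j then (1 : ℝ) else 0) - B.P (a n) (s n) j| ≤ 1
    rw [abs_le]
    split_ifs <;> constructor <;> linarith
  have hcent : ∀ j n, ∑ i, B.P (a n) (s n) i * Y j n i = 0 := by
    intro j n
    simp [hYdef, mul_sub, ← Finset.sum_mul, hP1]
  have hsum : ∀ j (s' : Fin N → Fin d),
      ∑ n, Y j n (s' n) = N * (config s' - B.meanField α (config s)) j := by
    intro j s'
    rw [Pi.sub_apply, mul_sub, ha.mul_meanField_config hinj hN, config,
      mul_div_cancel₀ _ hN'.ne', Finset.sum_sub_distrib, Finset.sum_boole]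
  have hpos : ∀ j, _ := fun j => sum_prod_filter_le_exp hP0 hP1 (hY j) (hcent j) hδ0.le hδ
  have hneg : ∀ j, _ := fun j => sum_prod_filter_le_exp (Y := fun n i => -Y j n i) hP0 hP1
    (fun n i => by rw [abs_neg]; exact hY j n i)
    (fun n => by simp [hcent]) hδ0.le hδ
  set E := Real.exp (-(δ ^ 2 / 4) * N)
  calc ∑ s' : Fin N → Fin d with δ < ‖config s' - B.meanField α (config s)‖,
        ∏ n, B.P (a n) (s n) (s' n)
      ≤ ∑ s' : Fin N → Fin d, ∑ j : Fin d,
        ((if N * δ ≤ ∑ n, Y j n (s' n) then ∏ n, B.P (a n) (s n) (s' n) else 0)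
          + if N * δ ≤ ∑ n, -Y j n (s' n) then ∏ n, B.P (a n) (s n) (s' n) else 0) := by
        rw [Finset.sum_filter]
        refine Finset.sum_le_sum fun s' _ => ?_
        have hp : 0 ≤ ∏ n, B.P (a n) (s n) (s' n) := Finset.prod_nonneg fun n _ => hP0 n _
        have hnn : ∀ c c' : Prop, ∀ [Decidable c] [Decidable c'],
            0 ≤ (if c then ∏ n, B.P (a n) (s n) (s' n) else 0)
              + if c' then ∏ n, B.P (a n) (s n) (s' n) else 0 := by
          intro c c' _ _
          split_ifs <;> linarith
        split_ifs with h
        · have : ∃ j, δ < |(config s' - B.meanField α (config s)) j| := by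
            by_contra! hall
            exact absurd h (not_lt.mpr ((pi_norm_le_iff_of_nonneg hδ0.le).mpr hall))
          obtain ⟨j, hj⟩ := this
          refine le_trans ?_ (Finset.single_le_sum (fun j _ => hnn _ _) (Finset.mem_univ j))
          rcases lt_abs.mp hj with hj | hj
          · rw [if_pos (show N * δ ≤ ∑ n, Y j n (s' n) by rw [hsum]; gcongr)]
            refine le_add_of_nonneg_right ?_
            split_ifs <;> linarith
          · rw [if_pos (show N * δ ≤ ∑ n, -Y j n (s' n) by
              rw [Finset.sum_neg_distrib, hsum, ← mul_neg]; gcongr)]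
            refine le_add_of_nonneg_left ?_
            split_ifs <;> linarith
        · exact Finset.sum_nonneg fun j _ => hnn _ _
    _ = ∑ j : Fin d, ((∑ s' : Fin N → Fin d with N * δ ≤ ∑ n, Y j n (s' n),
          ∏ n, B.P (a n) (s n) (s' n))
          + ∑ s' : Fin N → Fin d with N * δ ≤ ∑ n, -Y j n (s' n),
          ∏ n, B.P (a n) (s n) (s' n)) := by
        rw [Finset.sum_comm]
        simp only [Finset.sum_add_distrib, Finset.sum_filter]
    _ ≤ ∑ _j : Fin d, (E + E) := Finset.sum_le_sum fun j _ => add_le_add (hpos j) (hneg j)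
    _ = 2 * d * E := by simp; ring

theorem IsWhittlePolicy.sum_jointMatrix_le (hinj : Function.Injective B.whittleIndex) {α : ℝ}
    (hN : 0 < N) {π : Policy d N} (hπ : B.IsWhittlePolicy α π)
    {δ : ℝ} (hδ0 : 0 < δ) (hδ : δ ≤ 1) (s : Fin N → Fin d) :
    ∑ s' with δ < ‖config s' - B.meanField α (config s)‖, B.jointMatrix π s s'
      ≤ 2 * d * Real.exp (-(δ ^ 2 / 4) * N) := by
  simp only [jointMatrix, Matrix.of_apply]
  rw [Finset.sum_comm]
  simp only [← Finset.mul_sum]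
  calc _ ≤ ∑ a, (π s).1 a * (2 * d * Real.exp (-(δ ^ 2 / 4) * N)) := by
        refine Finset.sum_le_sum fun a _ => ?_
        by_cases h : (π s).1 a = 0
        · simp [h]
        · exact mul_le_mul_of_nonneg_left
            (IsWhittleAction.sum_prod_le hinj hN (hπ s a h) hδ0 hδ) ((π s).2.1 a)
    _ = _ := by rw [← Finset.sum_mul, (π s).2.2, one_mul]

theorem sum_mul_apply_le {ι : Type*} [Fintype ι] [DecidableEq ι] {P Q : Matrix ι ι ℝ}
    (hP : P ∈ rowStochastic ℝ ι) {K : ℝ} {S : Finset ι}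
    (h : ∀ u, ∑ s' ∈ S, Q u s' ≤ K) (s : ι) : ∑ s' ∈ S, (P * Q) s s' ≤ K := by
  simp only [mul_apply]
  rw [Finset.sum_comm]
  simp only [← Finset.mul_sum]
  refine (Finset.sum_le_sum fun u _ => mul_le_mul_of_nonneg_left (h u) (hP.1 s u)).trans ?_
  rw [← Finset.sum_mul, sum_row_of_mem_rowStochastic hP, one_mul]

/-- Over `k` steps, the configuration follows the mean-field dynamics up to an exponentially
unlikely event. -/
theorem exists_sum_jointMatrix_pow_le (hinj : Function.Injective B.whittleIndex) (α : ℝ) (k : ℕ) :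
    ∀ η > (0 : ℝ), ∃ C > (0 : ℝ), ∃ c > (0 : ℝ), ∀ N : ℕ, 0 < N → ∀ π : Policy d N,
      B.IsWhittlePolicy α π → ∀ s : Fin N → Fin d,
        ∑ s' with η < ‖config s' - (B.meanField α)^[k] (config s)‖, (B.jointMatrix π ^ k) s s'
          ≤ C * Real.exp (-c * N) := by
  induction k with
  | zero =>
    intro η hη
    refine ⟨1, one_pos, 1, one_pos, fun N hN π hπ s => ?_⟩
    rw [Finset.sum_eq_zero fun s' hs' => ?_]
    · positivity
    · rw [pow_zero, one_apply_ne]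
      rintro rfl
      have := (Finset.mem_filter.mp hs').2
      rw [Function.iterate_zero, id_eq, sub_self, norm_zero] at this
      exact this.not_gt hη
  | succ k ih =>
    intro η hη
    obtain ⟨δ, hδ, hcont⟩ := Metric.uniformContinuousOn_iff.mp
      ((isCompact_stdSimplex ℝ (Fin d)).uniformContinuousOn_of_continuous
        (B.continuous_meanField α).continuousOn) (η / 2) (by positivity)
    obtain ⟨C, hC, c, hc, hk⟩ := ih (δ / 2) (by positivity)
    set η' := min (η / 2) 1 with hη'
    have hη'0 : 0 < η' := by positivity
    set c' := η' ^ 2 / 4 with hc'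
    refine ⟨C + 2 * d, by positivity, min c c', by positivity, fun N hN π hπ s => ?_⟩
    have hQ := B.jointMatrix_mem π
    -- Either the first `k` steps already left the orbit, or they ended within `δ / 2` of it; then
    -- `φ` keeps the error below `η / 2` and the last step adds at most `η'`, outside its
    -- exceptional event.
    have hstep : ∀ u, ∑ s' with η < ‖config s' - (B.meanField α)^[k + 1] (config s)‖,
        B.jointMatrix π u s'
        ≤ (if δ / 2 < ‖config u - (B.meanField α)^[k] (config s)‖ then 1 else 0)
          + 2 * d * Real.exp (-c' * N) := by
      intro u
      split_ifs with hu
      · refine le_add_of_le_of_nonneg ?_ (by positivity)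
        rw [← sum_row_of_mem_rowStochastic hQ u]
        exact Finset.sum_le_sum_of_subset_of_nonneg (Finset.filter_subset _ _)
          fun s' _ _ => hQ.1 u s'
      · rw [zero_add]
        refine le_trans ?_ (hπ.sum_jointMatrix_le hinj hN hη'0 (min_le_right _ _) u)
        refine Finset.sum_le_sum_of_subset_of_nonneg
          (Finset.monotone_filter_right _ fun s' _ hs' => ?_) fun s' _ _ => hQ.1 u s'
        have h1 := hcont _ (config_mem_stdSimplex hN u) _
          (B.iterate_meanField_mem_stdSimplex α (config_mem_stdSimplex hN s) k)
          (by rw [dist_eq_norm]; linarith)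
        rw [dist_eq_norm, ← Function.iterate_succ_apply' (B.meanField α)] at h1
        have h2 := norm_sub_le_norm_sub_add_norm_sub (config s')
          (B.meanField α (config u)) ((B.meanField α)^[k + 1] (config s))
        refine (min_le_left _ _).trans_lt ?_
        linarith
    calc ∑ s' with η < ‖config s' - (B.meanField α)^[k + 1] (config s)‖,
          (B.jointMatrix π ^ (k + 1)) s s'
        = ∑ u, (B.jointMatrix π ^ k) s u
          * ∑ s' with η < ‖config s' - (B.meanField α)^[k + 1] (config s)‖,
            B.jointMatrix π u s' := by
          simp only [pow_succ, mul_apply]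
          rw [Finset.sum_comm]
          simp only [← Finset.mul_sum]
      _ ≤ ∑ u, (B.jointMatrix π ^ k) s u
          * ((if δ / 2 < ‖config u - (B.meanField α)^[k] (config s)‖ then 1 else 0)
          + 2 * d * Real.exp (-c' * N)) :=
          Finset.sum_le_sum fun u _ =>
            mul_le_mul_of_nonneg_left (hstep u) ((pow_mem hQ k).1 s u)
      _ = ∑ u with δ / 2 < ‖config u - (B.meanField α)^[k] (config s)‖,
            (B.jointMatrix π ^ k) s u + 2 * d * Real.exp (-c' * N) := by
          simp only [mul_add, Finset.sum_add_distrib, ← Finset.sum_mul,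
            sum_row_of_mem_rowStochastic (pow_mem hQ k), one_mul, mul_ite, mul_one, mul_zero,
            Finset.sum_filter]
      _ ≤ C * Real.exp (-c * N) + 2 * d * Real.exp (-c' * N) := by gcongr; exact hk N hN π hπ s
      _ ≤ C * Real.exp (-min c c' * N) + 2 * d * Real.exp (-min c c' * N) := by
          gcongr
          exacts [min_le_left _ _, min_le_right _ _]
      _ = _ := by ring

/-- Under the Whittle index policy, the configuration is eventually in any given neighbourhood
of a uniform global attractor, up to an exponentially unlikely event. -/
theorem IsUniformGlobalAttractor.exists_sum_jointMatrix_pow_le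
    (hinj : Function.Injective B.whittleIndex) {α : ℝ} {m₀ : Fin d → ℝ}
    (hattr : B.IsUniformGlobalAttractor α m₀) {p : (Fin d → ℝ) → Prop} [DecidablePred p]
    (hp : ∀ᶠ m in nhds m₀, p m) :
    ∃ T : ℕ, ∃ C > (0 : ℝ), ∃ c > (0 : ℝ), ∀ N : ℕ, 0 < N → ∀ π : Policy d N,
      B.IsWhittlePolicy α π → ∀ s : Fin N → Fin d, ∀ t ≥ T,
        ∑ s' with ¬ p (config s'), (B.jointMatrix π ^ t) s s' ≤ C * Real.exp (-c * N) := by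
  obtain ⟨r, hr, hball⟩ := Metric.eventually_nhds_iff.mp hp
  obtain ⟨T, hT⟩ := hattr (r / 3) (by positivity)
  obtain ⟨C, hC, c, hc, hconc⟩ := Bandit.exists_sum_jointMatrix_pow_le hinj α T (r / 3)
    (by positivity)
  refine ⟨T, C, hC, c, hc, fun N hN π hπ s t ht => ?_⟩
  have hQ := B.jointMatrix_mem π
  -- Only the last `T` steps matter: their bound is uniform in the state from which they start, so
  -- it does not depend on `t`.
  rw [← Nat.sub_add_cancel ht, pow_add]
  refine sum_mul_apply_le (pow_mem hQ _) (fun u => le_trans ?_ (hconc N hN π hπ u)) s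
  refine Finset.sum_le_sum_of_subset_of_nonneg
    (Finset.monotone_filter_right _ fun s' _ hs' => ?_) fun s' _ _ => (pow_mem hQ T).1 u s'
  by_contra! hle
  refine hs' (hball ?_)
  have h1 := hT T le_rfl _ (config_mem_stdSimplex hN u)
  have h2 := norm_sub_le_norm_sub_add_norm_sub (config s')
    ((B.meanField α)^[T] (config u)) m₀
  rw [dist_eq_norm]
  linarith

end Concentration

end Bandit

/-! ### The residual of a Whittle policy and the conclusion. -/

namespace Bandit

open Matrix

section WhittlePolicy

variable {d N : ℕ} {B : Bandit d}

theorem IsWhittlePolicy.jointActive_eq {α : ℝ} {π : Policy d N} (hπ : B.IsWhittlePolicy α π) :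
    jointActive π = fun _ => α * N := by
  ext s
  calc jointActive π s = ∑ a, (π s).1 a * (α * N) := by
        refine Finset.sum_congr rfl fun a _ => ?_
        by_cases h : (π s).1 a = 0
        · rw [h, zero_mul, zero_mul]
        · rw [← (hπ s a h).1, Finset.sum_boole]
    _ = α * N := by rw [← Finset.sum_mul, (π s).2.2, one_mul]

theorem IsWhittlePolicy.hasLongRunAverage_expectedActive {α : ℝ} {π : Policy d N}
    (hπ : B.IsWhittlePolicy α π) (s : Fin N → Fin d) :
    HasLongRunAverage (B.expectedActive π s) (α * N) :=
  hasLongRunAverage_of_poisson (B.jointMatrix_mem π) (h := 0)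
    (by rw [hπ.jointActive_eq]; ext; simp) s

/-- Under a Whittle index policy, there is no residual where the threshold state is `i`. -/
theorem IsWhittlePolicy.neg_jointResidual_le {α ν g K : ℝ} {h : Fin d → ℝ}
    (hN : 0 < N) {π : Policy d N} (hπ : B.IsWhittlePolicy α π)
    (hK : ∀ a j, -B.bellmanResidual ν g h a j ≤ K) {i : Fin d}
    (hact : ∀ j, B.whittleIndex i ≤ B.whittleIndex j → B.bellmanResidual ν g h true j = 0)
    (hpas : ∀ j, B.whittleIndex j ≤ B.whittleIndex i → B.bellmanResidual ν g h false j = 0)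
    {p : (Fin d → ℝ) → Prop} [DecidablePred p]
    (hp : ∀ m, p m → (∑ j with B.whittleIndex i < B.whittleIndex j, m j ≤ α) ∧
        α ≤ ∑ j with B.whittleIndex i ≤ B.whittleIndex j, m j) (s : Fin N → Fin d) :
    -B.jointResidual ν g h π s ≤ N * K * if ¬ p (config s) then 1 else 0 := by
  rw [jointResidual, ← Finset.sum_neg_distrib]
  have hpt : ∀ a ∈ Finset.univ, -((π s).1 a * ∑ n, B.bellmanResidual ν g h (a n) (s n))
      ≤ (π s).1 a * (N * K * if ¬ p (config s) then 1 else 0) := by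
    intro a _
    by_cases ha : (π s).1 a = 0
    · simp [ha]
    rw [← mul_neg]
    refine mul_le_mul_of_nonneg_left ?_ ((π s).2.1 a)
    by_cases hps : p (config s)
    · obtain ⟨hlow, hup⟩ := hp _ hps
      have hthr := IsWhittleAction.eq_of_threshold hN (hπ s a ha) hlow hup
      rw [if_neg (not_not.mpr hps), mul_zero, Finset.sum_eq_zero fun n _ => ?_, neg_zero]
      cases han : a n
      · refine hpas _ (not_lt.mp fun hlt => ?_)
        rw [(hthr n).1 hlt] at han
        cases han
      · refine hact _ (not_lt.mp fun hlt => ?_)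
        rw [(hthr n).2 hlt] at han
        cases han
    · rw [if_pos hps, mul_one, ← Finset.sum_neg_distrib]
      refine (Finset.sum_le_sum fun n _ => hK (a n) (s n)).trans ?_
      simp
  refine (Finset.sum_le_sum hpt).trans ?_
  rw [← Finset.sum_mul, (π s).2.2, one_mul]

/-- The residual costs at most `N * K`, and only outside the neighbourhood `p`. Times before `T` do
not influence the average, so no invariant distribution is needed. -/
theorem IsWhittlePolicy.neg_longRunAverage_jointResidual_le {α ν g K l ε : ℝ} {h : Fin d → ℝ}
    (hN : 0 < N) {π : Policy d N} (hπ : B.IsWhittlePolicy α π) (hK0 : 0 ≤ K)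
    (hK : ∀ a j, -B.bellmanResidual ν g h a j ≤ K) {i : Fin d}
    (hact : ∀ j, B.whittleIndex i ≤ B.whittleIndex j → B.bellmanResidual ν g h true j = 0)
    (hpas : ∀ j, B.whittleIndex j ≤ B.whittleIndex i → B.bellmanResidual ν g h false j = 0)
    {p : (Fin d → ℝ) → Prop} [DecidablePred p]
    (hp : ∀ m, p m → (∑ j with B.whittleIndex i < B.whittleIndex j, m j ≤ α) ∧
        α ≤ ∑ j with B.whittleIndex i ≤ B.whittleIndex j, m j)
    {s : Fin N → Fin d} {T : ℕ} (hε : 0 ≤ ε)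
    (htail : ∀ t ≥ T, ∑ s' with ¬ p (config s'), (B.jointMatrix π ^ t) s s' ≤ ε)
    (hl : HasLongRunAverage (fun t => (B.jointMatrix π ^ t *ᵥ B.jointResidual ν g h π) s) l) :
    -l ≤ N * K * ε := by
  have hQ := B.jointMatrix_mem π
  have hle : ∀ t, -1 * (B.jointMatrix π ^ t *ᵥ B.jointResidual ν g h π) s
      ≤ N * K * ∑ s' with ¬ p (config s'), (B.jointMatrix π ^ t) s s' := by
    intro t
    rw [neg_one_mul, Finset.sum_filter, Finset.mul_sum, mulVec, dotProduct,
      ← Finset.sum_neg_distrib]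
    refine Finset.sum_le_sum fun s' _ => ?_
    have := mul_le_mul_of_nonneg_left
      (hπ.neg_jointResidual_le hN hK hact hpas hp s') ((pow_mem hQ t).1 s s')
    rw [mul_neg] at this
    refine this.trans_eq ?_
    split_ifs <;> ring
  have hNK : 0 ≤ N * K := by positivity
  have := (hl.const_mul (-1)).le_of_eventually_le (T₀ := T) (K := N * K * ε) (C := N * K * 1)
    (by positivity) (fun t => (hle t).trans (mul_le_mul_of_nonneg_left ?_ hNK))
    fun t ht => (hle t).trans (mul_le_mul_of_nonneg_left (htail t ht) hNK)
  · linarith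
  · rw [← sum_row_of_mem_rowStochastic (pow_mem hQ t) s]
    exact Finset.sum_le_sum_of_subset_of_nonneg (Finset.filter_subset _ _)
      fun s' _ _ => (pow_mem hQ t).1 s s'

end WhittlePolicy

/-- This turns a fixed point of the mean-field map into a stationary distribution of the threshold
policy. -/
theorem vecMul_mixedMatrix_eq_meanField {d : ℕ} (B : Bandit d) {α : ℝ} {m θ : Fin d → ℝ}
    (hθ : ∀ j, B.activeMass α m j = m j * θ j) : m ᵥ* B.mixedMatrix θ = B.meanField α m := by
  ext j
  simp only [vecMul, dotProduct, mixedMatrix, Matrix.of_apply, meanField, hθ]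
  exact Finset.sum_congr rfl fun i _ => by ring

end Bandit

theorem mul_exp_neg_mul_le {c : ℝ} (hc : 0 < c) (x : ℝ) :
    x * Real.exp (-c * x) ≤ 2 / c * Real.exp (-(c / 2) * x) := by
  have h1 : x ≤ 2 / c * Real.exp (c / 2 * x) := by
    have h2 := (lt_add_one _).le.trans (Real.add_one_le_exp (c / 2 * x))
    calc x = 2 / c * (c / 2 * x) := by field_simp
      _ ≤ _ := by gcongr
  calc x * Real.exp (-c * x) ≤ 2 / c * Real.exp (c / 2 * x) * Real.exp (-c * x) := by gcongr
    _ = _ := by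
      rw [mul_assoc, ← Real.exp_add]
      ring_nf

theorem theorem2 {d : ℕ} (B : Bandit d) (α : ℝ) (hα₀ : 0 ≤ α) (hα₁ : α ≤ 1)
    (huni : B.IsUnichain) (hidx : B.IsStrictlyIndexable)
    (mstar : Fin d → ℝ) (hmem : mstar ∈ stdSimplex ℝ (Fin d))
    (hfix : B.meanField α mstar = mstar)
    (hattr : B.IsUniformGlobalAttractor α mstar)
    (hsing : ¬ B.IsSingular α mstar) :
    ∃ b > (0 : ℝ), ∃ c > (0 : ℝ), ∀ N : ℕ, (∃ k : ℕ, α * N = k) →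
      ∃ Vrel : ℝ, B.IsRelaxedValue α N Vrel ∧
        (∃ π : Bandit.Policy d N, B.IsWhittlePolicy α π) ∧
        ∀ π : Bandit.Policy d N, B.IsWhittlePolicy α π → ∀ s : Fin N → Fin d,
          ∃ Vwip : ℝ, HasLongRunAverage (B.expectedReward π s) Vwip ∧
            0 ≤ Vrel - Vwip ∧ Vrel - Vwip ≤ b * Real.exp (-c * N) := by
  classical
  obtain ⟨hmono, hinj⟩ := hidx
  obtain ⟨i, hlow, hup, hev⟩ := Bandit.exists_threshold hα₀ hα₁ hmem hsing
  have : Nonempty (Fin d) := ⟨i⟩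
  obtain ⟨θ, hθ0, hθ1, hθm, hθα, hθlo, hθhi⟩ :=
    Bandit.exists_threshold_policy hinj hmem.1 hlow hup
  obtain ⟨g, h, hle, hact, hpas⟩ := huni.exists_bellman_whittle hmono (B.whittleIndex i)
  obtain ⟨T, C, hC, c, hc, htail⟩ := hattr.exists_sum_jointMatrix_pow_le hinj hev
  obtain ⟨K, hK⟩ := Matrix.exists_forall_abs_le
    fun x : Bool × Fin d => B.bellmanResidual (B.whittleIndex i) g h x.1 x.2
  have hK0 : 0 ≤ K := (abs_nonneg _).trans (hK (true, i))
  -- The added 1 keeps `b` positive when `K = 0`.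
  refine ⟨(K * C + 1) * (2 / c), by positivity, c / 2, by positivity, fun N ⟨k, hk⟩ =>
    ⟨_, huni.isRelaxedValue hle hθ0 hθ1 hmem.2
      ((B.vecMul_mixedMatrix_eq_meanField hθm).trans hfix) hθα
      (fun j hj => hact j (not_lt.mp fun hlt => hj (hθlo j hlt)))
      (fun j hj => hpas j (not_lt.mp fun hlt => hj (hθhi j hlt))) N,
      B.exists_isWhittlePolicy hα₁ hk, fun π hπ s => ?_⟩⟩
  obtain ⟨l, hl⟩ := Matrix.exists_hasLongRunAverage (B.jointMatrix_mem π)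
    (B.jointResidual (B.whittleIndex i) g h π) s
  refine ⟨_, Bandit.hasLongRunAverage_expectedReward (hπ.hasLongRunAverage_expectedActive s) hl,
    by linarith [Bandit.longRunAverage_jointResidual_nonpos hle hl], ?_⟩
  rw [sub_add_cancel_left]
  -- For `N = 0` the configuration is not a probability vector, but all residuals are empty sums.
  rcases Nat.eq_zero_or_pos N with rfl | hN
  · have hres : B.jointResidual (B.whittleIndex i) g h π = 0 := by
      ext s
      simp [Bandit.jointResidual]
    rw [hres] at hl
    have h0 : l = 0 := hl.unique (by simpa using HasLongRunAverage.const 0)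
    rw [h0, neg_zero]
    positivity
  · have hgap := hπ.neg_longRunAverage_jointResidual_le hN hK0
      (fun a j => (neg_le_abs _).trans (hK (a, j))) hact hpas (fun m hm => hm) (by positivity)
      (htail N hN π hπ s) hl
    calc -l ≤ N * K * (C * Real.exp (-c * N)) := hgap
      _ = K * C * (N * Real.exp (-c * N)) := by ring
      _ ≤ (K * C + 1) * (N * Real.exp (-c * N)) := by gcongr; linarith
      _ ≤ (K * C + 1) * (2 / c * Real.exp (-(c / 2) * N)) := by
        exact mul_le_mul_of_nonneg_left (mul_exp_neg_mul_le hc N) (by positivity)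
      _ = _ := by ring
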